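/- Let $n\ge 2$, let $D,D'\subset\mathbb R^n$ be domains and let $\varphi:D\to D'$, $\varphi(D)=D'$, be a homeomorphism that belongs to the Sobolev space $L^1_q(D)$ for some $q\in(n-1,\infty]$; that is, its coordinate functions are locally integrable and weakly differentiable in $D$ with weak gradients in $L_q(D)$. Let $D\varphi$ be the matrix of weak partial derivatives of $\varphi$, $J(x,\varphi)=\det D\varphi(x)$, $\operatorname{adj}D\varphi$ the adjugate matrix, so that $\operatorname{adj}D\varphi\cdot D\varphi=J(\cdot,\varphi)\,\mathrm{Id}$, and let $|\cdot|$ denote the operator norm of matrices on Euclidean $\mathbb R^n$. There is a set $S\subset D$ of Lebesgue measure zero such that $\varphi$ restricted to $D\setminus S$ has the Luzin $N$-property, i.e. $|\varphi(E)|=0$ for every $E\subset D\setminus S$ with $|E|=0$ (if $\varphi$ itself has the Luzin $N$-property, one may take $S=\emptyset$). For every such $S$ and every choice of representative of $D\varphi$, define for $y\in D'$ $$ \mu(y)=\begin{cases}\dfrac{|\operatorname{adj}D\varphi|(x)}{|J(x,\varphi)|}, & x=\varphi^{-1}(y)\in D\setminus S\ \text{ and }\ J(x,\varphi)\neq 0,\\[2mm]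 0, & \text{otherwise.}\end{cases} $$ Then $\mu$ is locally integrable in $D'$. If, moreover, $\varphi$ has finite distortion, i.e. $D\varphi(x)=0$ for almost every $x\in D$ with $J(x,\varphi)=0$, then $$ \int_{D'}\mu(y)\,dy=\int_D|\operatorname{adj}D\varphi|(x)\,dx , $$ as an equality in $[0,\infty]$. -/

import Mathlib

open MeasureTheory Set
open scoped ENNReal

/-- `g` is a weak gradient of `f` in the open set `D`: both are locally integrable in `D`, and
`∫_D f ∂η/∂xᵢ = - ∫_D gᵢ η` for all smooth `η` with compact support in `D` and all `i`. -/
def HasWeakGradientOn {n : ℕ} (D : Set (EuclideanSpace ℝ (Fin n)))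
    (f : EuclideanSpace ℝ (Fin n) → ℝ)
    (g : EuclideanSpace ℝ (Fin n) → EuclideanSpace ℝ (Fin n)) : Prop :=
  LocallyIntegrableOn f D volume ∧ LocallyIntegrableOn g D volume ∧
    ∀ η : EuclideanSpace ℝ (Fin n) → ℝ, ContDiff ℝ (⊤ : ℕ∞) η → HasCompactSupport η →
      tsupport η ⊆ D → ∀ i : Fin n,
        ∫ x in D, f x * fderiv ℝ η x (EuclideanSpace.single i 1) = - ∫ x in D, g x i * η x

/-- The Sobolev space `L¹_q(D)`: locally integrable functions `f` on `D` that have a weak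
gradient in `D` whose Euclidean norm belongs to `L_q(D)`. -/
def MemSobolevL1 {n : ℕ} (q : ℝ≥0∞) (D : Set (EuclideanSpace ℝ (Fin n)))
    (f : EuclideanSpace ℝ (Fin n) → ℝ) : Prop :=
  ∃ g : EuclideanSpace ℝ (Fin n) → EuclideanSpace ℝ (Fin n),
    HasWeakGradientOn D f g ∧ MemLp g q (volume.restrict D)

/-- A mapping belongs to `L¹_q(D)` if all its coordinate functions do. -/
def MapMemSobolevL1 {n : ℕ} (q : ℝ≥0∞) (D : Set (EuclideanSpace ℝ (Fin n)))
    (φ : EuclideanSpace ℝ (Fin n) → EuclideanSpace ℝ (Fin n)) : Prop :=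
  ∀ i : Fin n, MemSobolevL1 q D (fun x => φ x i)

/-- The matrix field `A` is (a version of) the formal Jacobi matrix `Dφ` in `D`: its `i`-th row is
a weak gradient of the coordinate function `φᵢ`. -/
def IsWeakJacobiMatrix {n : ℕ} (D : Set (EuclideanSpace ℝ (Fin n)))
    (φ : EuclideanSpace ℝ (Fin n) → EuclideanSpace ℝ (Fin n))
    (A : EuclideanSpace ℝ (Fin n) → Matrix (Fin n) (Fin n) ℝ) : Prop :=
  ∀ i : Fin n, HasWeakGradientOn D (fun x => φ x i) (fun x => WithLp.toLp 2 (A x i))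

/-- The norm `|M|` of a matrix: the norm of the linear operator that it defines on Euclidean
space. -/
noncomputable def matNorm {n : ℕ} (M : Matrix (Fin n) (Fin n) ℝ) : ℝ :=
  ‖Matrix.toEuclideanCLM (n := Fin n) (𝕜 := ℝ) M‖

/-- The Luzin `N`-property of `φ` on the set `A`: subsets of `A` of measure zero have images of
measure zero. -/
def LuzinNOn {n : ℕ} (φ : EuclideanSpace ℝ (Fin n) → EuclideanSpace ℝ (Fin n))
    (A : Set (EuclideanSpace ℝ (Fin n))) : Prop :=
  ∀ E ⊆ A, volume E = 0 → volume (φ '' E) = 0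

/-- `S` is an exceptional set for `φ` in `D`: a null set off which `φ` has the Luzin
`N`-property. -/
def IsExceptionalSet {n : ℕ} (D : Set (EuclideanSpace ℝ (Fin n)))
    (φ : EuclideanSpace ℝ (Fin n) → EuclideanSpace ℝ (Fin n))
    (S : Set (EuclideanSpace ℝ (Fin n))) : Prop :=
  S ⊆ D ∧ volume S = 0 ∧ LuzinNOn φ (D \ S)

/-- Finite distortion of a mapping with Jacobi matrix `A`: `A` vanishes at almost every point of
`D` at which its determinant vanishes. -/
def FiniteDistortion {n : ℕ} (D : Set (EuclideanSpace ℝ (Fin n)))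
    (A : EuclideanSpace ℝ (Fin n) → Matrix (Fin n) (Fin n) ℝ) : Prop :=
  ∀ᵐ x ∂(volume.restrict D), (A x).det = 0 → A x = 0

open Classical in
/-- The function `μ(y) = |adj Dφ|(x) / |J(x, φ)|`, `x = φ⁻¹(y)`, if `x ∈ D \ S` and
`J(x, φ) ≠ 0`, and `μ(y) = 0` otherwise; here `D` is the source of `φ` and `A` is `Dφ`.
Only the values at points `y` of the target of `φ` are meaningful. -/
noncomputable def muFun {n : ℕ}
    (φ : OpenPartialHomeomorph (EuclideanSpace ℝ (Fin n)) (EuclideanSpace ℝ (Fin n)))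
    (A : EuclideanSpace ℝ (Fin n) → Matrix (Fin n) (Fin n) ℝ)
    (S : Set (EuclideanSpace ℝ (Fin n))) (y : EuclideanSpace ℝ (Fin n)) : ℝ :=
  if φ.symm y ∈ φ.source \ S ∧ (A (φ.symm y)).det ≠ 0 then
    matNorm (A (φ.symm y)).adjugate / |(A (φ.symm y)).det|
  else 0

/-! The map `φ` need not be differentiable almost everywhere in the usual sense, but almost all of
`D` splits into countably many disjoint measurable sets `T l` such that `φ` restricted to `T l` is
differentiable at each point of `T l`, with derivative `Dφ` (`IsWeakJacobiMatrix.exists_cover`). Put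
`G = ⋃ l, T l`. Differentiable maps send null sets to null sets, so `D \ G` is an exceptional set.
The area formula for the injective `φ` on the sets `T l` turns the integral of `μ` over `φ(B ∩ G)`
into that of `|adj Dφ|` over the part of `B` where `J ≠ 0`. For any exceptional `S`, `φ(D \ G)`
contributes nothing: `μ = 0` on `φ(S)`, and the rest of `D \ G` has a null image. This is
`IsWeakJacobiMatrix.lintegral_muFun`. Local integrability follows from `|adj Dφ| ≤ C |Dφ|^(n-1)` on
compact sets; under finite distortion `adj Dφ = 0` almost everywhere on `J = 0`, and `B = D` gives
the equality.

The cover comes from a Poincaré inequality for averages over balls. Telescoped over shrinking radii,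
it bounds increments of a continuous Sobolev function by the means of its gradient. Applied to `f`
minus a linear function at Lebesgue points of the gradient, it makes `φ` nearly linear on countably
many sets. There `φ` is Lipschitz, so Rademacher's theorem applies, and ever finer approximations
identify the derivative with `Dφ`. -/

open scoped Convolution Topology

/-! ### Poincaré inequality for smooth functions -/

section Poincare

variable {E : Type*} [NormedAddCommGroup E] [NormedSpace ℝ E]

theorem enorm_sub_le_lintegral_fderiv {u : E → ℝ} (hu : ContDiff ℝ 1 u) (a b : E) :
    ‖u b - u a‖ₑ ≤ ∫⁻ t in Ioc (0 : ℝ) 1, ‖fderiv ℝ u (a + t • (b - a)) (b - a)‖ₑ := by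
  have hd : ∀ t ∈ uIcc (0 : ℝ) 1, HasDerivAt (fun t : ℝ => u (a + t • (b - a)))
      (fderiv ℝ u (a + t • (b - a)) (b - a)) t := by
    intro t _
    have h1 : HasFDerivAt u (fderiv ℝ u (a + t • (b - a))) (a + t • (b - a)) :=
      (hu.differentiable one_ne_zero _).hasFDerivAt
    have h2 : HasDerivAt (fun t : ℝ => a + t • (b - a)) (b - a) t := by
      simpa using ((hasDerivAt_id t).smul_const (b - a)).const_add a
    exact h1.comp_hasDerivAt t h2
  have hc : Continuous fun t : ℝ => fderiv ℝ u (a + t • (b - a)) (b - a) :=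
    ((hu.continuous_fderiv one_ne_zero).comp (by fun_prop)).clm_apply continuous_const
  have := intervalIntegral.integral_eq_sub_of_hasDerivAt hd (hc.intervalIntegrable _ _)
  simp only [one_smul, zero_smul, add_zero, add_sub_cancel] at this
  rw [← this, intervalIntegral.integral_of_le zero_le_one]
  exact enorm_integral_le_lintegral_enorm _

variable [FiniteDimensional ℝ E] [MeasurableSpace E] [BorelSpace E] (μ : Measure E)
  [μ.IsAddHaarMeasure]

theorem setLIntegral_ball_comp_homothety (G : E → ℝ≥0∞) (b : E) {s : ℝ} (hs : 0 < s) :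
    ∫⁻ z in Metric.ball (0 : E) 1, G (b + s • z) ∂μ =
      ENNReal.ofReal (s⁻¹ ^ Module.finrank ℝ E) * ∫⁻ z in Metric.ball b s, G z ∂μ := by
  have himg : (fun z : E => b + s • z) '' Metric.ball (0 : E) 1 = Metric.ball b s := by
    have := image_comp (fun z => b + z) (fun z : E => s • z) (Metric.ball (0 : E) 1)
    simp only [Function.comp_def] at this
    rw [this, image_smul, smul_ball hs.ne', image_add_left, Metric.preimage_add_left_ball]
    simp [abs_of_pos hs]
  have hd : ∀ z ∈ Metric.ball (0 : E) 1, HasFDerivWithinAt (fun z : E => b + s • z)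
      (s • ContinuousLinearMap.id ℝ E) (Metric.ball (0 : E) 1) z := fun z _ =>
    (((hasFDerivAt_id z).const_smul s).const_add b).hasFDerivWithinAt
  have hinj : InjOn (fun z : E => b + s • z) (Metric.ball (0 : E) 1) := by
    intro z _ w _ h
    exact smul_right_injective E hs.ne' (add_left_cancel h)
  have h := lintegral_image_eq_lintegral_abs_det_fderiv_mul μ Metric.isOpen_ball.measurableSet
    hd hinj G
  have hdet : |(s • ContinuousLinearMap.id ℝ E).det| = s ^ Module.finrank ℝ E := by
    have : (s • ContinuousLinearMap.id ℝ E).det = s ^ Module.finrank ℝ E := by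
      simp [ContinuousLinearMap.det, LinearMap.det_smul]
    rw [this, abs_of_pos (by positivity)]
  rw [himg] at h
  simp only [hdet] at h
  rw [h, lintegral_const_mul' _ _ ENNReal.ofReal_ne_top, ← mul_assoc, ← ENNReal.ofReal_mul
    (by positivity), ← mul_pow, inv_mul_cancel₀ hs.ne']
  simp

/-- A Poincaré type inequality for averages over two balls, one of half the radius of the other. -/
theorem enorm_integral_ball_sub_le {u : E → ℝ} (hu : ContDiff ℝ 1 u) {H : E → ℝ≥0∞}
    (hH : Measurable H) {x y : E} {r : ℝ} (hr : 0 < r) (hxy : ‖x - y‖ ≤ r)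
    (huH : ∀ p ∈ Metric.ball x (2 * r), ∀ v, ‖fderiv ℝ u p v‖ₑ ≤ ‖v‖ₑ * H p) :
    ‖(∫ z in Metric.ball (0 : E) 1, u (x + r • z) ∂μ)
        - ∫ z in Metric.ball (0 : E) 1, u (y + (r / 2) • z) ∂μ‖ₑ ≤
      ENNReal.ofReal (2 * r) * ∫⁻ t in Ioc (0 : ℝ) 1, ∫⁻ z in Metric.ball (0 : E) 1,
        H ((y + t • (x - y)) + ((1 + t) * (r / 2)) • z) ∂μ := by
  have hint : ∀ (a : E) (s : ℝ),
      Integrable (fun z => u (a + s • z)) (μ.restrict (Metric.ball (0 : E) 1)) := by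
    intro a s
    have : Continuous fun z => u (a + s • z) := hu.continuous.comp (by fun_prop)
    exact (this.continuousOn.integrableOn_compact (isCompact_closedBall (0 : E) 1)).mono_set
      Metric.ball_subset_closedBall
  rw [← integral_sub (hint _ _) (hint _ _)]
  refine (enorm_integral_le_lintegral_enorm _).trans ?_
  -- At time `t` the segments from `y + (r/2)z` to `x + rz` sweep a ball of radius `(1+t)r/2 ≥ r/2`
  -- inside the ball of radius `2r` about `x`. The radius stays away from `0`, so the homothety
  -- factors stay bounded; each segment has length at most `2r`.
  have hpt : ∀ (t : ℝ) (z : E), (y + (r / 2) • z) + t • ((x + r • z) - (y + (r / 2) • z)) =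
      (y + t • (x - y)) + ((1 + t) * (r / 2)) • z := by
    intro t z; module
  have key : ∀ z ∈ Metric.ball (0 : E) 1, ‖u (x + r • z) - u (y + (r / 2) • z)‖ₑ ≤
      ∫⁻ t in Ioc (0 : ℝ) 1, ENNReal.ofReal (2 * r) *
        H ((y + t • (x - y)) + ((1 + t) * (r / 2)) • z) := by
    intro z hz
    refine (enorm_sub_le_lintegral_fderiv hu _ _).trans ?_
    refine setLIntegral_mono' measurableSet_Ioc fun t ht => ?_
    have hz1 : ‖z‖ < 1 := by simpa using hz
    rw [hpt]
    refine (huH _ ?_ _).trans ?_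
    · rw [Metric.mem_ball, dist_eq_norm]
      have : y + t • (x - y) + ((1 + t) * (r / 2)) • z - x =
        ((1 + t) * (r / 2)) • z - (1 - t) • (x - y) := by module
      rw [this]
      refine (norm_sub_le _ _).trans_lt ?_
      rw [norm_smul, norm_smul, Real.norm_of_nonneg (by nlinarith [ht.1]),
        Real.norm_of_nonneg (by linarith [ht.2])]
      have h1 : (1 + t) * (r / 2) * ‖z‖ < (1 + t) * (r / 2) * 1 := by
        have := ht.1
        gcongr
      have h2 : (1 - t) * ‖x - y‖ ≤ (1 - t) * r := by
        have := ht.2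
        gcongr
      nlinarith [ht.1]
    · gcongr
      rw [← ofReal_norm]
      refine ENNReal.ofReal_le_ofReal ?_
      have : x + r • z - (y + (r / 2) • z) = (x - y) + (r / 2) • z := by module
      rw [this]
      refine (norm_add_le _ _).trans ?_
      rw [norm_smul, Real.norm_of_nonneg (by positivity)]
      nlinarith
  refine (setLIntegral_mono' Metric.isOpen_ball.measurableSet key).trans ?_
  have hm : Measurable fun q : E × ℝ =>
      H ((y + q.2 • (x - y)) + ((1 + q.2) * (r / 2)) • q.1) :=
    hH.comp (Continuous.measurable (by fun_prop))
  rw [lintegral_lintegral_swap (hm.const_mul _).aemeasurable]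
  simp_rw [lintegral_const_mul' _ _ ENNReal.ofReal_ne_top]
  exact le_rfl

end Poincare

/-! ### Calculus of weak gradients -/

section WeakGradient

variable {n : ℕ}

theorem HasWeakGradientOn.integral_mul_fderiv {D : Set (EuclideanSpace ℝ (Fin n))}
    {f : EuclideanSpace ℝ (Fin n) → ℝ} {g : EuclideanSpace ℝ (Fin n) → EuclideanSpace ℝ (Fin n)}
    (h : HasWeakGradientOn D f g) (hD : IsOpen D) {η : EuclideanSpace ℝ (Fin n) → ℝ}
    (hη : ContDiff ℝ (⊤ : ℕ∞) η) (hc : HasCompactSupport η) (hs : tsupport η ⊆ D)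
    (v : EuclideanSpace ℝ (Fin n)) :
    ∫ x in D, f x * fderiv ℝ η x v = - ∫ x in D, inner ℝ (g x) v * η x := by
  have hfi : ∀ w, Integrable (fun x => f x * fderiv ℝ η x w) (volume.restrict D) := by
    intro w
    have h1 : IntegrableOn f (tsupport η) := h.1.integrableOn_compact_subset hs hc
    have hcont : Continuous fun x => fderiv ℝ η x w :=
      (hη.continuous_fderiv (by simp)).clm_apply continuous_const
    have h2 : IntegrableOn (fun x => f x * fderiv ℝ η x w) (tsupport η) :=
      h1.mul_continuousOn hcont.continuousOn hc
    refine (h2.of_forall_sdiff_eq_zero hD.measurableSet fun x hx => ?_)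
    have : fderiv ℝ η x = 0 := by
      by_contra hne
      exact hx.2 (support_fderiv_subset ℝ hne)
    simp [this]
  have hgi : ∀ i, Integrable (fun x => g x i * η x) (volume.restrict D) := by
    intro i
    have h1 : IntegrableOn g (tsupport η) := h.2.1.integrableOn_compact_subset hs hc
    have h1' : IntegrableOn (fun x => g x i) (tsupport η) :=
      (EuclideanSpace.proj (𝕜 := ℝ) i).integrable_comp h1
    have h2 : IntegrableOn (fun x => g x i * η x) (tsupport η) :=
      h1'.mul_continuousOn hη.continuous.continuousOn hc
    refine (h2.of_forall_sdiff_eq_zero hD.measurableSet fun x hx => ?_)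
    simp [image_eq_zero_of_notMem_tsupport hx.2]
  have e1 : ∀ x, f x * fderiv ℝ η x v =
      ∑ i, v i * (f x * fderiv ℝ η x (EuclideanSpace.single i 1)) := by
    intro x
    conv_lhs => rw [← (EuclideanSpace.basisFun (Fin n) ℝ).sum_repr v]
    simp only [map_sum, map_smul, EuclideanSpace.basisFun_repr, EuclideanSpace.basisFun_apply,
      smul_eq_mul, Finset.mul_sum]
    exact Finset.sum_congr rfl fun i _ => by ring
  have e2 : ∀ x, inner ℝ (g x) v * η x = ∑ i, v i * (g x i * η x) := by
    intro x
    simp only [PiLp.inner_apply, RCLike.inner_apply, conj_trivial, Finset.sum_mul]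
    exact Finset.sum_congr rfl fun i _ => by ring
  simp_rw [e1, e2]
  rw [integral_finsetSum _ fun i _ => (hfi _).const_mul _,
    integral_finsetSum _ fun i _ => (hgi i).const_mul (v i), ← Finset.sum_neg_distrib]
  refine Finset.sum_congr rfl fun i _ => ?_
  rw [integral_const_mul, integral_const_mul, h.2.2 η hη hc hs i, mul_neg]

theorem HasWeakGradientOn.congr {D : Set (EuclideanSpace ℝ (Fin n))}
    {f : EuclideanSpace ℝ (Fin n) → ℝ} {g g' : EuclideanSpace ℝ (Fin n) → EuclideanSpace ℝ (Fin n)}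
    (h : HasWeakGradientOn D f g) (hD : IsOpen D) (hg : g =ᵐ[volume.restrict D] g') :
    HasWeakGradientOn D f g' := by
  refine ⟨h.1, ?_, fun η h1 h2 h3 i => ?_⟩
  · rw [locallyIntegrableOn_iff hD.isLocallyClosed]
    intro K hK hKc
    exact ((h.2.1.integrableOn_compact_subset hK hKc).congr
      (ae_restrict_of_ae_restrict_of_subset hK hg))
  · rw [h.2.2 η h1 h2 h3 i]
    congr 1
    refine integral_congr_ae (hg.mono fun x hx => ?_)
    simp only [hx]

/-- This reduces approximation of `f` by a linear function to an estimate for a function whose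
gradient `g - c` is small on average. -/
theorem HasWeakGradientOn.sub_inner {D : Set (EuclideanSpace ℝ (Fin n))}
    {f : EuclideanSpace ℝ (Fin n) → ℝ} {g : EuclideanSpace ℝ (Fin n) → EuclideanSpace ℝ (Fin n)}
    (h : HasWeakGradientOn D f g) (hD : IsOpen D) (c : EuclideanSpace ℝ (Fin n)) :
    HasWeakGradientOn D (fun x => f x - inner ℝ c x) (fun x => g x - c) := by
  have hcont : Continuous fun x : EuclideanSpace ℝ (Fin n) => inner ℝ c x := by fun_prop
  refine ⟨h.1.sub (hcont.locallyIntegrable.locallyIntegrableOn _),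
    h.2.1.sub (continuous_const.locallyIntegrable.locallyIntegrableOn _), fun η h1 h2 h3 i => ?_⟩
  have hηc : Continuous fun x => fderiv ℝ η x (EuclideanSpace.single i 1) :=
      (h1.continuous_fderiv (by simp)).clm_apply continuous_const
  have hη'0 : ∀ x, x ∉ tsupport η → fderiv ℝ η x = 0 := by
    intro x hx
    by_contra hne
    exact hx (support_fderiv_subset ℝ hne)
  have i1 : Integrable (fun x => f x * fderiv ℝ η x (EuclideanSpace.single i 1))
      (volume.restrict D) := by
    refine (((h.1.integrableOn_compact_subset h3 h2).mul_continuousOn hηc.continuousOn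
      h2).of_forall_sdiff_eq_zero hD.measurableSet fun x hx => ?_)
    simp [hη'0 x hx.2]
  have i2 : Integrable (fun x => inner ℝ c x * fderiv ℝ η x (EuclideanSpace.single i 1)) :=
    (hcont.mul hηc).integrable_of_hasCompactSupport ((h2.fderiv_apply ℝ _).mul_left)
  have i3 : Integrable (fun x => g x i * η x) (volume.restrict D) := by
    refine IntegrableOn.of_forall_sdiff_eq_zero (IntegrableOn.mul_continuousOn (K := tsupport η)
      ((EuclideanSpace.proj (𝕜 := ℝ) i).integrable_comp
        (h.2.1.integrableOn_compact_subset h3 h2))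
      h1.continuous.continuousOn h2) hD.measurableSet fun x hx => ?_
    simp [image_eq_zero_of_notMem_tsupport hx.2]
  have i4 : Integrable (fun x => c i * η x) :=
    (continuous_const.mul h1.continuous).integrable_of_hasCompactSupport h2.mul_left
  have key : ∫ x in D, inner ℝ c x * fderiv ℝ η x (EuclideanSpace.single i 1) =
      - ∫ x in D, c i * η x := by
    rw [setIntegral_eq_integral_of_forall_compl_eq_zero fun x hx => by
        simp [hη'0 x fun h => hx (h3 h)],
      setIntegral_eq_integral_of_forall_compl_eq_zero fun x hx => by
        simp [image_eq_zero_of_notMem_tsupport fun h => hx (h3 h)]]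
    have hfd : ∀ x : EuclideanSpace ℝ (Fin n),
        fderiv ℝ (fun x => inner ℝ c x) x (EuclideanSpace.single i 1) = c i := by
      intro x
      have : (fun x => inner ℝ c x) = (innerSL ℝ c : EuclideanSpace ℝ (Fin n) → ℝ) := by
        ext; simp
      rw [this, ContinuousLinearMap.fderiv]
      simp [EuclideanSpace.inner_single_right]
    have := integral_mul_fderiv_eq_neg_fderiv_mul_of_integrable (μ := volume)
      (f := fun x => inner ℝ c x) (g := η) (v := EuclideanSpace.single i (1 : ℝ))
      (by simpa [hfd] using i4) i2
      ((hcont.mul h1.continuous).integrable_of_hasCompactSupport h2.mul_left)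
      (fun x _ => (innerSL ℝ c).differentiableAt) (fun x _ => h1.differentiable (by simp) x)
    simpa [hfd] using this
  simp only [sub_mul, PiLp.sub_apply]
  rw [integral_sub i1 i2.restrict, integral_sub i3 i4.restrict, key, h.2.2 η h1 h2 h3 i]
  ring

end WeakGradient

/-! ### Mollification of Sobolev functions -/

section Mollification

variable {n : ℕ}

/-- The kernel `R(p - ·)` is itself a test function supported in `K`, so the derivative falls on
`g`. Truncating `f` to `K` makes it globally integrable and is not seen by this kernel. -/
theorem HasWeakGradientOn.enorm_fderiv_convolution_le {D : Set (EuclideanSpace ℝ (Fin n))}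
    {f : EuclideanSpace ℝ (Fin n) → ℝ} {g : EuclideanSpace ℝ (Fin n) → EuclideanSpace ℝ (Fin n)}
    (h : HasWeakGradientOn D f g) (hD : IsOpen D) {K : Set (EuclideanSpace ℝ (Fin n))}
    (hK : IsCompact K) (hKD : K ⊆ D) (ρ : ContDiffBump (0 : EuclideanSpace ℝ (Fin n)))
    {p : EuclideanSpace ℝ (Fin n)} (hp : Metric.closedBall p ρ.rOut ⊆ K)
    (v : EuclideanSpace ℝ (Fin n)) :
    ‖fderiv ℝ (ρ.normed volume ⋆[ContinuousLinearMap.lsmul ℝ ℝ] K.indicator f) p v‖ₑ ≤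
      ‖v‖ₑ * ∫⁻ w, ‖ρ.normed volume w‖ₑ * ‖g (p - w)‖ₑ := by
  set R := ρ.normed volume with hR
  have hRs : ContDiff ℝ (⊤ : ℕ∞) R := ρ.contDiff_normed
  have hfK : LocallyIntegrable (K.indicator f) volume :=
    ((integrable_indicator_iff hK.measurableSet).2
      (h.1.integrableOn_compact_subset hKD hK)).locallyIntegrable
  have hRc : HasCompactSupport R := ρ.hasCompactSupport_normed
  have hder := hRc.hasFDerivAt_convolution_right (ContinuousLinearMap.lsmul ℝ ℝ).flip hfK
    (hRs.of_le (by simp)) p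
  rw [convolution_flip] at hder
  rw [hder.fderiv]
  set η : EuclideanSpace ℝ (Fin n) → ℝ := fun z => R (p - z) with hη
  have hηs : ContDiff ℝ (⊤ : ℕ∞) η := hRs.comp (contDiff_const.sub contDiff_id)
  have hsupp : ∀ z, z ∉ Metric.ball p ρ.rOut → η z = 0 := by
    intro z hz
    have : p - z ∉ Function.support R := by
      rw [hR, ρ.support_normed_eq]
      simpa [dist_eq_norm, norm_sub_rev] using hz
    simpa using this
  have hts : tsupport η ⊆ Metric.closedBall p ρ.rOut := by
    refine closure_minimal (fun z hz => ?_) Metric.isClosed_closedBall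
    by_contra hne
    exact hz (hsupp z fun h => hne (Metric.ball_subset_closedBall h))
  have hηc : HasCompactSupport η :=
    (isCompact_closedBall p ρ.rOut).of_isClosed_subset (isClosed_tsupport _) hts
  have hηd : ∀ z, fderiv ℝ η z v = - fderiv ℝ R (p - z) v := by
    intro z
    have h1 : HasFDerivAt R (fderiv ℝ R (p - z)) (p - z) :=
      (hRs.differentiable (by simp) _).hasFDerivAt
    have h2 : HasFDerivAt (fun z => p - z) (-ContinuousLinearMap.id ℝ _) z :=
      (hasFDerivAt_id z).const_sub p
    have h3 : HasFDerivAt η _ z := h1.comp z h2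
    rw [h3.fderiv]
    simp
  have hconv : ((K.indicator f ⋆[(ContinuousLinearMap.lsmul ℝ ℝ).flip.precompR _] fderiv ℝ R) p) v
      = ∫ z, K.indicator f z * fderiv ℝ R (p - z) v := by
    rw [convolution_def, ContinuousLinearMap.integral_apply]
    · refine integral_congr_ae (Filter.Eventually.of_forall fun z => ?_)
      simp [mul_comm]
    · exact ((hRc.fderiv ℝ).convolutionExists_right _ hfK
        (hRs.continuous_fderiv (by simp)) p)
  have hη0 : ∀ z, z ∉ K → fderiv ℝ η z v = 0 := by
    intro z hz
    have : fderiv ℝ η z = 0 := by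
      by_contra hne
      exact hz (hp (hts (support_fderiv_subset ℝ hne)))
    simp [this]
  have e1 : ∫ z, K.indicator f z * fderiv ℝ R (p - z) v = ∫ z in D, inner ℝ (g z) v * η z := by
    have := h.integral_mul_fderiv hD hηs hηc (hts.trans (hp.trans hKD)) v
    rw [← neg_eq_iff_eq_neg] at this
    rw [← this, ← integral_neg, setIntegral_eq_integral_of_forall_compl_eq_zero]
    · refine integral_congr_ae (Filter.Eventually.of_forall fun z => ?_)
      by_cases hz : z ∈ K
      · simp [hz, hηd]
      · have := hη0 z hz
        have h2 := hηd z
        simp only [this] at h2 ⊢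
        simp [hz]
    · intro z hz
      simp [hη0 z fun hk => hz (hKD hk)]
  rw [hconv, e1]
  refine (enorm_integral_le_lintegral_enorm _).trans ((setLIntegral_le_lintegral _ _).trans ?_)
  rw [← lintegral_const_mul' _ _ (by simp)]
  rw [← lintegral_sub_left_eq_self (fun w => ‖v‖ₑ * (‖R w‖ₑ * ‖g (p - w)‖ₑ)) p]
  refine lintegral_mono fun z => ?_
  simp only [sub_sub_cancel, enorm_mul]
  rw [mul_comm ‖v‖ₑ, mul_comm, mul_assoc]
  gcongr ‖R (p - z)‖ₑ * ?_
  rw [← ofReal_norm, ← ofReal_norm, ← ofReal_norm, ← ENNReal.ofReal_mul (norm_nonneg _)]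
  exact ENNReal.ofReal_le_ofReal (norm_inner_le_norm _ _)

/-- For each fixed shift `w` of size at most `r` the ball about `a - w` of radius `s` stays in the
ball of radius `3r` about `x`, with Jacobian factor `s⁻ⁿ ≤ (2/r)ⁿ`; the kernel has mass one. The
bound does not depend on `ρ`, so it survives the limit of mollifications. -/
theorem ContDiffBump.lintegral_ball_lintegral_normed_mul_le
    (ρ : ContDiffBump (0 : EuclideanSpace ℝ (Fin n)))
    {G : EuclideanSpace ℝ (Fin n) → ℝ≥0∞} (hG : Measurable G)
    {x a : EuclideanSpace ℝ (Fin n)} {r s : ℝ} (hr : 0 < r) (hs : r / 2 ≤ s)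
    (ha : ‖a - x‖ + s ≤ 2 * r) (hρ : ρ.rOut ≤ r) :
    ∫⁻ z in Metric.ball (0 : EuclideanSpace ℝ (Fin n)) 1,
        ∫⁻ w, ‖ρ.normed volume w‖ₑ * G ((a + s • z) - w) ≤
      ENNReal.ofReal ((2 / r) ^ n) * ∫⁻ z in Metric.ball x (3 * r), G z := by
  have hs0 : 0 < s := by linarith
  have hm : Measurable fun q : EuclideanSpace ℝ (Fin n) × EuclideanSpace ℝ (Fin n) =>
      ‖ρ.normed volume q.2‖ₑ * G ((a + s • q.1) - q.2) := by
    have h1 : Continuous (ρ.normed volume) := ρ.continuous_normed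
    refine (Continuous.measurable ?_).mul (hG.comp (Continuous.measurable (by fun_prop)))
    exact (h1.comp continuous_snd).enorm
  rw [lintegral_lintegral_swap hm.aemeasurable]
  have key : ∀ w, ∫⁻ z in Metric.ball (0 : EuclideanSpace ℝ (Fin n)) 1,
      ‖ρ.normed volume w‖ₑ * G ((a + s • z) - w) ≤
      ‖ρ.normed volume w‖ₑ *
        (ENNReal.ofReal ((2 / r) ^ n) * ∫⁻ z in Metric.ball x (3 * r), G z) := by
    intro w
    rw [lintegral_const_mul' _ _ (by simp)]
    by_cases hw : w ∈ Metric.ball (0 : EuclideanSpace ℝ (Fin n)) ρ.rOut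
    · gcongr
      have : ∀ z, a + s • z - w = (a - w) + s • z := fun z => by abel
      simp_rw [this]
      rw [setLIntegral_ball_comp_homothety volume G (a - w) hs0, finrank_euclideanSpace_fin]
      gcongr
      · rw [inv_eq_one_div, div_le_div_iff₀ hs0 hr]; linarith
      · refine Metric.ball_subset_ball' ?_
        have hw' : ‖w‖ < ρ.rOut := by simpa using hw
        rw [dist_eq_norm]
        have : ‖a - w - x‖ ≤ ‖a - x‖ + ‖w‖ := by
          rw [sub_right_comm]; exact norm_sub_le _ _
        linarith
    · have : ρ.normed volume w = 0 := by
        rw [← Function.notMem_support, ρ.support_normed_eq]; exact hw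
      simp [this]
  refine (lintegral_mono key).trans ?_
  rw [lintegral_mul_const _ (ρ.continuous_normed.enorm.measurable)]
  have : ∫⁻ w, ‖ρ.normed volume w‖ₑ = 1 := by
    have h1 := ofReal_integral_eq_lintegral_ofReal (μ := volume) (f := ρ.normed volume)
      ρ.integrable_normed (Filter.Eventually.of_forall ρ.nonneg_normed)
    rw [ρ.integral_normed] at h1
    rw [← ENNReal.ofReal_one, h1]
    refine lintegral_congr fun w => ?_
    rw [← ofReal_norm, Real.norm_of_nonneg (ρ.nonneg_normed w)]
  rw [this, one_mul]

end Mollification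

/-! ### From ball averages to pointwise increments -/

section BallAverages

variable {n : ℕ}

theorem integrableOn_ball_comp_homothety {f : EuclideanSpace ℝ (Fin n) → ℝ}
    {a : EuclideanSpace ℝ (Fin n)} {s : ℝ} (hs : 0 < s)
    (hf : ContinuousOn f (Metric.closedBall a s)) :
    IntegrableOn (fun z => f (a + s • z)) (Metric.ball (0 : EuclideanSpace ℝ (Fin n)) 1) := by
  have : ContinuousOn (fun z => f (a + s • z))
      (Metric.closedBall (0 : EuclideanSpace ℝ (Fin n)) 1) := by
    refine hf.comp (Continuous.continuousOn (by fun_prop)) fun z hz => ?_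
    have hz' : ‖z‖ ≤ 1 := by simpa using hz
    rw [Metric.mem_closedBall, dist_eq_norm, add_sub_cancel_left, norm_smul,
      Real.norm_of_nonneg hs.le]
    nlinarith
  exact (this.integrableOn_compact (isCompact_closedBall _ _)).mono_set
    Metric.ball_subset_closedBall

theorem homothety_mem_ball {a z : EuclideanSpace ℝ (Fin n)} {s : ℝ} (hs : 0 < s)
    (hz : z ∈ Metric.ball (0 : EuclideanSpace ℝ (Fin n)) 1) : a + s • z ∈ Metric.ball a s := by
  have hz' : ‖z‖ < 1 := by simpa using hz
  rw [Metric.mem_ball, dist_eq_norm, add_sub_cancel_left, norm_smul, Real.norm_of_nonneg hs.le]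
  nlinarith

theorem HasWeakGradientOn.enorm_integral_ball_sub_le {D : Set (EuclideanSpace ℝ (Fin n))}
    {f : EuclideanSpace ℝ (Fin n) → ℝ} {g : EuclideanSpace ℝ (Fin n) → EuclideanSpace ℝ (Fin n)}
    (h : HasWeakGradientOn D f g) (hD : IsOpen D) (hf : ContinuousOn f D) (hg : Measurable g)
    {x y : EuclideanSpace ℝ (Fin n)} {r : ℝ} (hr : 0 < r) (hxy : ‖x - y‖ ≤ r)
    (hx : Metric.closedBall x (3 * r) ⊆ D) :
    ‖(∫ z in Metric.ball (0 : EuclideanSpace ℝ (Fin n)) 1, f (x + r • z))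
        - ∫ z in Metric.ball (0 : EuclideanSpace ℝ (Fin n)) 1, f (y + (r / 2) • z)‖ₑ ≤
      ENNReal.ofReal (2 * r) * (ENNReal.ofReal ((2 / r) ^ n) *
        ∫⁻ z in Metric.ball x (3 * r), ‖g z‖ₑ) := by
  set K := Metric.closedBall x (3 * r) with hK
  have hKc : IsCompact K := isCompact_closedBall _ _
  have hKm : MeasurableSet K := hKc.measurableSet
  let ρ : ℕ → ContDiffBump (0 : EuclideanSpace ℝ (Fin n)) := fun k =>
    ⟨r / (k + 1) / 2, r / (k + 1), by positivity, half_lt_self (by positivity)⟩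
  have hρr : ∀ k, (ρ k).rOut ≤ r := fun k => div_le_self hr.le (by
    have : (0 : ℝ) ≤ k := k.cast_nonneg
    linarith)
  have hρ0 : Filter.Tendsto (fun k => (ρ k).rOut) Filter.atTop (𝓝 0) := by
    have := tendsto_one_div_add_atTop_nhds_zero_nat (𝕜 := ℝ) |>.const_mul r
    simpa [ρ, div_eq_mul_inv] using this
  set u : ℕ → EuclideanSpace ℝ (Fin n) → ℝ := fun k =>
    (ρ k).normed volume ⋆[ContinuousLinearMap.lsmul ℝ ℝ] K.indicator f with hu
  have hfK : Integrable (K.indicator f) volume :=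
    (integrable_indicator_iff hKm).2 ((hf.mono hx).integrableOn_compact hKc)
  have hus : ∀ k, ContDiff ℝ 1 (u k) := fun k =>
    (ρ k).hasCompactSupport_normed.contDiff_convolution_left (n := 1) _ (ρ k).contDiff_normed
      hfK.locallyIntegrable
  obtain ⟨M, hM⟩ := hKc.exists_bound_of_continuousOn (hf.mono hx)
  have hM' : ∀ p, ‖K.indicator f p‖ ≤ |M| := by
    intro p
    by_cases hp : p ∈ K
    · simpa [hp] using (hM p hp).trans (le_abs_self M)
    · simp [hp]
  -- The mollification differs from the truncated function by at most its oscillation `2|M|`. This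
  -- provides the dominating constant.
  have hub : ∀ k p, ‖u k p‖ ≤ 3 * |M| := by
    intro k p
    have h1 := (ρ k).dist_normed_convolution_le (μ := volume) (g := K.indicator f) (x₀ := p)
      (ε := 2 * |M|) hfK.aestronglyMeasurable (fun q _ => by
        rw [dist_eq_norm]
        linarith [norm_sub_le (K.indicator f q) (K.indicator f p), hM' q, hM' p])
    rw [dist_eq_norm] at h1
    have h2 := norm_le_norm_add_norm_sub' (u k p) (K.indicator f p)
    have h3 := hM' p
    simp only [hu] at h2 ⊢
    linarith
  -- Only the open ball is used: the truncation may jump at the boundary of `K`.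
  have hut : ∀ p ∈ Metric.ball x (3 * r),
      Filter.Tendsto (fun k => u k p) Filter.atTop (𝓝 (f p)) := by
    intro p hp
    have hpK : p ∈ K := Metric.ball_subset_closedBall hp
    have hcont : ContinuousAt (K.indicator f) p := by
      have hfp : ContinuousAt f p := hf.continuousAt (hD.mem_nhds (hx hpK))
      refine hfp.congr ?_
      filter_upwards [Metric.isOpen_ball.mem_nhds hp] with q hq
      simp [show q ∈ K from Metric.ball_subset_closedBall hq]
    have := ContDiffBump.convolution_tendsto_right (μ := volume) (φ := ρ) (l := Filter.atTop)
      (g := fun _ => K.indicator f) (k := fun _ => p) (x₀ := p) (z₀ := K.indicator f p) hρ0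
      (Filter.Eventually.of_forall fun _ => hfK.aestronglyMeasurable)
      (hcont.tendsto.comp Filter.tendsto_snd) tendsto_const_nhds
    simpa [hpK] using this
  have hlim : ∀ (a : EuclideanSpace ℝ (Fin n)) (s : ℝ), 0 < s → ‖a - x‖ + s ≤ 3 * r →
      Filter.Tendsto
        (fun k => ∫ z in Metric.ball (0 : EuclideanSpace ℝ (Fin n)) 1, u k (a + s • z))
        Filter.atTop
        (𝓝 (∫ z in Metric.ball (0 : EuclideanSpace ℝ (Fin n)) 1, f (a + s • z))) := by
    intro a s hs has
    refine tendsto_integral_of_dominated_convergence (fun _ => 3 * |M|) (fun k => ?_) ?_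
      (fun k => Filter.Eventually.of_forall fun z => hub k _) ?_
    · exact ((hus k).continuous.comp (by fun_prop)).aestronglyMeasurable
    · exact integrableOn_const (by simp [Metric.isBounded_ball.measure_lt_top.ne])
    · refine (ae_restrict_iff' Metric.isOpen_ball.measurableSet).2
        (Filter.Eventually.of_forall fun z hz => hut _ ?_)
      refine Metric.ball_subset_ball' ?_ (homothety_mem_ball hs hz)
      rw [dist_eq_norm]; linarith
  have hineq : ∀ k, ‖(∫ z in Metric.ball (0 : EuclideanSpace ℝ (Fin n)) 1, u k (x + r • z))
        - ∫ z in Metric.ball (0 : EuclideanSpace ℝ (Fin n)) 1, u k (y + (r / 2) • z)‖ₑ ≤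
      ENNReal.ofReal (2 * r) * (ENNReal.ofReal ((2 / r) ^ n) *
        ∫⁻ z in Metric.ball x (3 * r), ‖g z‖ₑ) := by
    intro k
    have hmH : Measurable fun p : EuclideanSpace ℝ (Fin n) =>
        ∫⁻ w, ‖(ρ k).normed volume w‖ₑ * ‖g (p - w)‖ₑ := by
      refine Measurable.lintegral_prod_right' (f := fun q : _ × EuclideanSpace ℝ (Fin n) =>
        ‖(ρ k).normed volume q.2‖ₑ * ‖g (q.1 - q.2)‖ₑ) ?_
      have h1 : Continuous ((ρ k).normed volume) := (ρ k).continuous_normed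
      exact ((h1.comp continuous_snd).enorm.measurable).mul
        (hg.comp (measurable_fst.sub measurable_snd)).enorm
    refine (_root_.enorm_integral_ball_sub_le volume (hus k) hmH hr hxy
      (fun p hp v => h.enorm_fderiv_convolution_le hD hKc hx (ρ k) ?_ v)).trans ?_
    · refine Metric.closedBall_subset_closedBall' ?_
      have : dist p x < 2 * r := hp
      linarith [hρr k]
    · gcongr
      have : ∀ t ∈ Ioc (0 : ℝ) 1,
          ∫⁻ z in Metric.ball (0 : EuclideanSpace ℝ (Fin n)) 1, ∫⁻ w,
            ‖(ρ k).normed volume w‖ₑ *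
              ‖g (y + t • (x - y) + ((1 + t) * (r / 2)) • z - w)‖ₑ ≤
          ENNReal.ofReal ((2 / r) ^ n) * ∫⁻ z in Metric.ball x (3 * r), ‖g z‖ₑ := by
        intro t ht
        refine (ρ k).lintegral_ball_lintegral_normed_mul_le hg.enorm hr ?_ ?_ (hρr k)
        · nlinarith [ht.1]
        · have e : y + t • (x - y) - x = (-(1 - t)) • (x - y) := by module
          rw [e, norm_smul, norm_neg, Real.norm_of_nonneg (by linarith [ht.2])]
          have : (1 - t) * ‖x - y‖ ≤ (1 - t) * r := by
            have := ht.2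
            gcongr
          nlinarith [ht.1]
      refine (setLIntegral_mono' measurableSet_Ioc this).trans ?_
      simp
  have hL := ((hlim x r hr (by simp; linarith)).sub
    (hlim y (r / 2) (by positivity) (by rw [norm_sub_rev]; linarith))).enorm
  exact le_of_tendsto' hL hineq

theorem HasWeakGradientOn.abs_integral_ball_sub_le {D : Set (EuclideanSpace ℝ (Fin n))}
    {f : EuclideanSpace ℝ (Fin n) → ℝ} {g : EuclideanSpace ℝ (Fin n) → EuclideanSpace ℝ (Fin n)}
    (h : HasWeakGradientOn D f g) (hD : IsOpen D) (hf : ContinuousOn f D) (hg : Measurable g)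
    {x y : EuclideanSpace ℝ (Fin n)} {r δ : ℝ} (hr : 0 < r) (hδ : 0 ≤ δ) (hxy : ‖x - y‖ ≤ r)
    (hx : Metric.closedBall x (3 * r) ⊆ D)
    (hI : ∫⁻ z in Metric.ball x (3 * r), ‖g z‖ₑ ≤ ENNReal.ofReal (δ * (3 * r) ^ n)) :
    |(∫ z in Metric.ball (0 : EuclideanSpace ℝ (Fin n)) 1, f (x + r • z))
        - ∫ z in Metric.ball (0 : EuclideanSpace ℝ (Fin n)) 1, f (y + (r / 2) • z)| ≤
      2 * 6 ^ n * δ * r := by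
  have h1 := h.enorm_integral_ball_sub_le hD hf hg hr hxy hx
  have h2 := h1.trans (by gcongr :
    _ ≤ ENNReal.ofReal (2 * r) * (ENNReal.ofReal ((2 / r) ^ n) *
      ENNReal.ofReal (δ * (3 * r) ^ n)))
  rw [← ENNReal.ofReal_mul (by positivity), ← ENNReal.ofReal_mul (by positivity),
    ← ofReal_norm, ENNReal.ofReal_le_ofReal_iff (by positivity), Real.norm_eq_abs] at h2
  refine h2.trans_eq ?_
  have : (2 / r) ^ n * (δ * (3 * r) ^ n) = 6 ^ n * δ := by
    rw [mul_left_comm, ← mul_pow]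
    have : 2 / r * (3 * r) = 6 := by field_simp; norm_num
    rw [this, mul_comm]
  rw [this]; ring

/-- Telescoping over the radii `r/2^k`: consecutive averages differ by at most `2·6ⁿδr/2^k`, a
geometric series, and by continuity they tend to the value at the centre times the volume of the
unit ball. -/
theorem HasWeakGradientOn.abs_integral_ball_sub_const_le {D : Set (EuclideanSpace ℝ (Fin n))}
    {f : EuclideanSpace ℝ (Fin n) → ℝ} {g : EuclideanSpace ℝ (Fin n) → EuclideanSpace ℝ (Fin n)}
    (h : HasWeakGradientOn D f g) (hD : IsOpen D) (hf : ContinuousOn f D) (hg : Measurable g)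
    {x : EuclideanSpace ℝ (Fin n)} {r δ : ℝ} (hr : 0 < r) (hδ : 0 ≤ δ)
    (hx : Metric.closedBall x (3 * r) ⊆ D)
    (hI : ∀ s, 0 < s → s ≤ 3 * r →
      ∫⁻ z in Metric.ball x s, ‖g z‖ₑ ≤ ENNReal.ofReal (δ * s ^ n)) :
    |(∫ z in Metric.ball (0 : EuclideanSpace ℝ (Fin n)) 1, f (x + r • z))
        - volume.real (Metric.ball (0 : EuclideanSpace ℝ (Fin n)) 1) * f x| ≤
      2 * (2 * 6 ^ n * δ * r) := by
  have hk : ∀ k : ℕ, 0 < r / 2 ^ k ∧ r / 2 ^ k ≤ r := fun k =>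
    ⟨by positivity, div_le_self hr.le (one_le_pow₀ (by norm_num))⟩
  have hstep : ∀ k : ℕ, dist
      (∫ z in Metric.ball (0 : EuclideanSpace ℝ (Fin n)) 1, f (x + (r / 2 ^ k) • z))
      (∫ z in Metric.ball (0 : EuclideanSpace ℝ (Fin n)) 1, f (x + (r / 2 ^ (k + 1)) • z)) ≤
      2 * (2 * 6 ^ n * δ * r) / 2 / 2 ^ k := by
    intro k
    obtain ⟨h0, h1⟩ := hk k
    have := h.abs_integral_ball_sub_le hD hf hg (x := x) (y := x) h0 hδ (by simpa using h0.le)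
      ((Metric.closedBall_subset_closedBall (by linarith)).trans hx)
      (hI _ (by positivity) (by linarith))
    rw [Real.dist_eq, pow_succ, ← div_div]
    refine this.trans_eq ?_
    ring
  have htend : Filter.Tendsto (fun k : ℕ =>
      ∫ z in Metric.ball (0 : EuclideanSpace ℝ (Fin n)) 1, f (x + (r / 2 ^ k) • z)) Filter.atTop
      (𝓝 (volume.real (Metric.ball (0 : EuclideanSpace ℝ (Fin n)) 1) * f x)) := by
    have hxD : x ∈ D := hx (Metric.mem_closedBall_self (by positivity))
    obtain ⟨M, hM⟩ := (isCompact_closedBall x (3 * r)).exists_bound_of_continuousOn (hf.mono hx)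
    have e : volume.real (Metric.ball (0 : EuclideanSpace ℝ (Fin n)) 1) * f x =
        ∫ z in Metric.ball (0 : EuclideanSpace ℝ (Fin n)) 1, f x := by
      rw [setIntegral_const, smul_eq_mul]
    rw [e]
    refine tendsto_integral_of_dominated_convergence (fun _ => M) (fun k => ?_) ?_
      (fun k => ?_) ?_
    · obtain ⟨h0, h1⟩ := hk k
      exact (integrableOn_ball_comp_homothety h0 (hf.mono
        ((Metric.closedBall_subset_closedBall (by linarith)).trans hx))).aestronglyMeasurable
    · exact integrableOn_const (by simp [Metric.isBounded_ball.measure_lt_top.ne])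
    · refine (ae_restrict_iff' Metric.isOpen_ball.measurableSet).2
        (Filter.Eventually.of_forall fun z hz => hM _ ?_)
      obtain ⟨h0, h1⟩ := hk k
      exact Metric.ball_subset_closedBall (Metric.ball_subset_ball (by linarith)
        (homothety_mem_ball h0 hz))
    · refine Filter.Eventually.of_forall fun z => ?_
      have hc : ContinuousAt f x := hf.continuousAt (hD.mem_nhds hxD)
      have h2 : Filter.Tendsto (fun k : ℕ => r / 2 ^ k) Filter.atTop (𝓝 0) := by
        have := (tendsto_pow_atTop_nhds_zero_of_lt_one (r := (1 / 2 : ℝ)) (by norm_num)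
          (by norm_num)).const_mul r
        simpa [div_eq_mul_inv] using this
      have h3 : Filter.Tendsto (fun k : ℕ => x + (r / 2 ^ k) • z) Filter.atTop (𝓝 x) := by
        simpa using (h2.smul_const z).const_add x
      exact hc.tendsto.comp h3
  have := dist_le_of_le_geometric_two_of_tendsto₀ hstep htend
  simpa [Real.dist_eq] using this

/-- If the mean values of the weak gradient of `f` over small balls about two points are bounded
by a constant, then the increment of `f` is bounded in terms of this constant. -/
theorem HasWeakGradientOn.abs_sub_le {D : Set (EuclideanSpace ℝ (Fin n))}
    {f : EuclideanSpace ℝ (Fin n) → ℝ} {g : EuclideanSpace ℝ (Fin n) → EuclideanSpace ℝ (Fin n)}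
    (h : HasWeakGradientOn D f g) (hD : IsOpen D) (hf : ContinuousOn f D) (hg : Measurable g)
    {x y : EuclideanSpace ℝ (Fin n)} {δ R : ℝ} (hδ : 0 ≤ δ) (hxy : 3 * ‖x - y‖ ≤ R)
    (hx : Metric.closedBall x R ⊆ D)
    (hIx : ∀ s, 0 < s → s ≤ R →
      ∫⁻ z in Metric.ball x s, ‖g z‖ₑ ≤ ENNReal.ofReal (δ * s ^ n))
    (hIy : ∀ s, 0 < s → s ≤ R →
      ∫⁻ z in Metric.ball y s, ‖g z‖ₑ ≤ ENNReal.ofReal (δ * s ^ n)) :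
    volume.real (Metric.ball (0 : EuclideanSpace ℝ (Fin n)) 1) * |f x - f y| ≤
      8 * 6 ^ n * δ * ‖x - y‖ := by
  rcases eq_or_ne x y with rfl | hne
  · simp
  have hr : 0 < ‖x - y‖ := norm_pos_iff.2 (sub_ne_zero.2 hne)
  set r := ‖x - y‖ with hrd
  have hx' : Metric.closedBall x (3 * r) ⊆ D :=
    (Metric.closedBall_subset_closedBall hxy).trans hx
  -- The chain is `f x`, average on `B(x, r)`, average on `B(y, r/2)`, `f y`. The links cost `4`,
  -- `2` and `2` times `6ⁿδr`, whence the constant `8`.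
  have h1 := h.abs_integral_ball_sub_const_le hD hf hg hr hδ hx'
    fun s hs hs' => hIx s hs (hs'.trans hxy)
  have h2 := h.abs_integral_ball_sub_le hD hf hg (y := y) hr hδ le_rfl hx'
    (hIx _ (by positivity) hxy)
  have h3 := h.abs_integral_ball_sub_const_le hD hf hg (x := y) (half_pos hr) hδ
    ((Metric.closedBall_subset_closedBall' (by
      rw [dist_comm, dist_eq_norm, ← hrd]; linarith)).trans hx')
    fun s hs hs' => hIy s hs (by linarith)
  set ω := volume.real (Metric.ball (0 : EuclideanSpace ℝ (Fin n)) 1)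
  have hω : 0 ≤ ω := measureReal_nonneg
  have e : ω * |f x - f y| = |ω * f x - ω * f y| := by
    rw [← mul_sub, abs_mul, abs_of_nonneg hω]
  rw [e]
  rw [abs_le] at h1 h2 h3 ⊢
  constructor <;> nlinarith

end BallAverages

/-! ### Approximation by linear maps on countably many sets -/

section LinearApproximation

variable {n : ℕ}

/-- Lebesgue differentiation is applied to the truncations of `g` to countably many open sets on
which it is integrable; small balls do not see the truncation. -/
theorem MeasureTheory.LocallyIntegrableOn.ae_tendsto_lintegral_enorm_sub_div
    {D : Set (EuclideanSpace ℝ (Fin n))} (hD : IsOpen D)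
    {g : EuclideanSpace ℝ (Fin n) → EuclideanSpace ℝ (Fin n)}
    (hg : LocallyIntegrableOn g D volume) :
    ∀ᵐ x ∂(volume.restrict D), Filter.Tendsto (fun r =>
      (∫⁻ y in Metric.closedBall x r, ‖g y - g x‖ₑ) / volume (Metric.closedBall x r))
      (𝓝[>] 0) (𝓝 0) := by
  obtain ⟨u, hu, hDu, hui⟩ := hg.exists_nat_integrableOn
  have hopen : ∀ k, IsOpen (u k ∩ D) := fun k => (hu k).inter hD
  have key : ∀ k, ∀ᵐ x ∂(volume : Measure (EuclideanSpace ℝ (Fin n))),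
      Filter.Tendsto (fun a => (∫⁻ y in a,
        ‖(u k ∩ D).indicator g y - (u k ∩ D).indicator g x‖ₑ) / volume a)
        ((Besicovitch.vitaliFamily volume).filterAt x) (𝓝 0) := fun k =>
    (Besicovitch.vitaliFamily volume).ae_tendsto_lintegral_enorm_sub_div
      ((integrable_indicator_iff (hopen k).measurableSet).2 (hui k)).locallyIntegrable
  rw [ae_restrict_iff' hD.measurableSet]
  filter_upwards [ae_all_iff.2 key] with x hx hxD
  obtain ⟨k, hk⟩ := mem_iUnion.1 (hDu hxD)
  have hxk : x ∈ u k ∩ D := ⟨hk, hxD⟩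
  refine ((hx k).comp (Besicovitch.tendsto_filterAt volume x)).congr' ?_
  obtain ⟨ε, hε, hεs⟩ := Metric.nhds_basis_closedBall.mem_iff.1 ((hopen k).mem_nhds hxk)
  filter_upwards [Ioc_mem_nhdsGT hε] with r hr
  simp only [Function.comp_apply]
  congr 1
  refine setLIntegral_congr_fun Metric.isClosed_closedBall.measurableSet fun y hy => ?_
  have hyk : y ∈ u k ∩ D := hεs (Metric.closedBall_subset_closedBall hr.2 hy)
  simp only [indicator_of_mem hyk, indicator_of_mem hxk]

theorem eventually_lintegral_ball_enorm_sub_le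
    {g : EuclideanSpace ℝ (Fin n) → EuclideanSpace ℝ (Fin n)}
    {x c : EuclideanSpace ℝ (Fin n)} {δ : ℝ} (hδ : 0 < δ) (hc : ‖g x - c‖ ≤ δ)
    (hx : Filter.Tendsto (fun r =>
      (∫⁻ y in Metric.closedBall x r, ‖g y - g x‖ₑ) / volume (Metric.closedBall x r))
      (𝓝[>] 0) (𝓝 0)) :
    ∀ᶠ s in 𝓝[>] (0 : ℝ), ∫⁻ y in Metric.ball x s, ‖g y - c‖ₑ ≤
      ENNReal.ofReal (2 * δ * volume.real (Metric.ball (0 : EuclideanSpace ℝ (Fin n)) 1) *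
        s ^ n) := by
  have h0 : (0 : ℝ≥0∞) < ENNReal.ofReal δ := by simpa using hδ
  filter_upwards [hx.eventually (gt_mem_nhds h0), self_mem_nhdsWithin] with s hs hs0
  have hs0 : 0 < s := hs0
  have hvpos : volume (Metric.closedBall x s) ≠ 0 := (Metric.measure_closedBall_pos _ _ hs0).ne'
  have hvtop : volume (Metric.closedBall x s) ≠ ∞ := measure_closedBall_lt_top.ne
  have h1 : ∫⁻ y in Metric.closedBall x s, ‖g y - g x‖ₑ ≤
      ENNReal.ofReal δ * volume (Metric.closedBall x s) :=
    (ENNReal.div_le_iff hvpos hvtop).1 hs.le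
  calc ∫⁻ y in Metric.ball x s, ‖g y - c‖ₑ
      ≤ ∫⁻ y in Metric.closedBall x s, ‖g y - c‖ₑ := lintegral_mono_set Metric.ball_subset_closedBall
    _ ≤ ∫⁻ y in Metric.closedBall x s, (‖g y - g x‖ₑ + ENNReal.ofReal δ) := by
        refine lintegral_mono fun y => ?_
        have : g y - c = (g y - g x) + (g x - c) := by abel
        rw [this]
        refine (enorm_add_le _ _).trans ?_
        gcongr
        rw [← ofReal_norm]
        exact ENNReal.ofReal_le_ofReal hc
    _ = (∫⁻ y in Metric.closedBall x s, ‖g y - g x‖ₑ) +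
          ENNReal.ofReal δ * volume (Metric.closedBall x s) := by
        rw [lintegral_add_right _ measurable_const]; simp
    _ ≤ ENNReal.ofReal δ * volume (Metric.closedBall x s) +
          ENNReal.ofReal δ * volume (Metric.closedBall x s) := by gcongr
    _ = _ := by
        rw [← two_mul, Measure.addHaar_closedBall volume x hs0.le, finrank_euclideanSpace_fin,
          ← ofReal_measureReal (Metric.isBounded_ball.measure_lt_top.ne),
          ← ENNReal.ofReal_mul (by positivity), ← ENNReal.ofReal_mul (by positivity),
          two_mul, ← ENNReal.ofReal_add (by positivity) (by positivity)]
        congr 1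
        ring

/-- A continuous function with a weak gradient is, on countably many sets that cover almost all of
its domain, arbitrarily well approximated by linear functions close to its gradient. -/
theorem HasWeakGradientOn.exists_linear_approx {D : Set (EuclideanSpace ℝ (Fin n))}
    {f : EuclideanSpace ℝ (Fin n) → ℝ} {g : EuclideanSpace ℝ (Fin n) → EuclideanSpace ℝ (Fin n)}
    (h : HasWeakGradientOn D f g) (hD : IsOpen D) (hf : ContinuousOn f D) (hg : Measurable g)
    {δ : ℝ} (hδ : 0 < δ) :
    ∃ (t : ℕ × ℕ × ℕ → Set (EuclideanSpace ℝ (Fin n)))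
      (c : ℕ × ℕ × ℕ → EuclideanSpace ℝ (Fin n)),
      (∀ᵐ x ∂(volume.restrict D), ∃ l, x ∈ t l) ∧ ∀ l, t l ⊆ D ∧ (∀ x ∈ t l, ‖g x - c l‖ ≤ δ) ∧
        ∀ x ∈ t l, ∀ y ∈ t l, |f x - f y - inner ℝ (c l) (x - y)| ≤
          16 * 6 ^ n * δ * ‖x - y‖ := by
  set ω := volume.real (Metric.ball (0 : EuclideanSpace ℝ (Fin n)) 1) with hω
  have hω0 : 0 < ω := ENNReal.toReal_pos (Metric.measure_ball_pos _ _ one_pos).ne'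
    Metric.isBounded_ball.measure_lt_top.ne
  let d := TopologicalSpace.denseSeq (EuclideanSpace ℝ (Fin n))
  have hd : ∀ (x : EuclideanSpace ℝ (Fin n)) (ε : ℝ), 0 < ε → ∃ k, dist x (d k) < ε := by
    intro x ε hε
    obtain ⟨k, hk⟩ := (TopologicalSpace.denseRange_denseSeq _).exists_dist_lt x hε
    exact ⟨k, hk⟩
  -- In the index `(j, m, k)`, `d j` approximates the gradient, `1/(m+1)` is the scale below which
  -- its means are controlled, and `d k` localises: two points of a set are closer than a third of
  -- that scale, as `abs_sub_le` demands.
  refine ⟨fun l => {x | x ∈ D ∧ Metric.closedBall x (1 / (l.2.1 + 1)) ⊆ D ∧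
      dist x (d l.2.2) < 1 / (6 * (l.2.1 + 1)) ∧ ‖g x - d l.1‖ ≤ δ ∧
      ∀ s, 0 < s → s ≤ 1 / (l.2.1 + 1 : ℝ) → ∫⁻ y in Metric.ball x s, ‖g y - d l.1‖ₑ ≤
        ENNReal.ofReal (2 * δ * ω * s ^ n)}, fun l => d l.1, ?_, fun l => ⟨fun x hx => hx.1,
      fun x hx => hx.2.2.2.1, fun x hx y hy => ?_⟩⟩
  · filter_upwards [h.2.1.ae_tendsto_lintegral_enorm_sub_div hD, ae_restrict_mem hD.measurableSet]
      with x hx hxD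
    obtain ⟨j, hj⟩ := hd (g x) δ hδ
    rw [dist_eq_norm] at hj
    have hev := eventually_lintegral_ball_enorm_sub_le hδ hj.le hx
    obtain ⟨ε, hε, hεD⟩ := Metric.nhds_basis_closedBall.mem_iff.1 (hD.mem_nhds hxD)
    obtain ⟨ε', hε', hεI⟩ := mem_nhdsGT_iff_exists_Ioc_subset.1 hev
    obtain ⟨m, hm⟩ := exists_nat_one_div_lt (lt_min hε hε')
    obtain ⟨k, hk⟩ := hd x (1 / (6 * ((m : ℝ) + 1))) (by positivity)
    refine ⟨(j, m, k), hxD, (Metric.closedBall_subset_closedBall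
      (hm.le.trans (min_le_left _ _))).trans hεD, hk, hj.le, fun s hs hs' => hεI
        ⟨hs, hs'.trans (hm.le.trans (min_le_right _ _))⟩⟩
  · obtain ⟨-, hx1, hx2, -, hx3⟩ := hx
    obtain ⟨-, -, hy2, -, hy3⟩ := hy
    have hxy : 3 * ‖x - y‖ ≤ 1 / (l.2.1 + 1) := by
      have h1 := dist_triangle_right x y (d l.2.2)
      rw [dist_eq_norm x y] at h1
      have h2 : 1 / (6 * ((l.2.1 : ℝ) + 1)) = 1 / (l.2.1 + 1) / 6 := by
        rw [div_div, mul_comm]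
      linarith
    have := (h.sub_inner hD (d l.1)).abs_sub_le hD (hf.sub (by fun_prop)) (hg.sub_const _)
      (δ := 2 * δ * ω) (by positivity) hxy hx1 hx3 hy3
    have e : f x - f y - inner ℝ (d l.1) (x - y) =
        f x - inner ℝ (d l.1) x - (f y - inner ℝ (d l.1) y) := by
      rw [inner_sub_right]; ring
    rw [e]
    refine le_of_mul_le_mul_left (this.trans_eq ?_) hω0
    ring

/-- A continuous mapping with a weak Jacobi matrix is, on countably many sets that cover almost all
of its domain, arbitrarily well approximated by linear mappings close to its Jacobi matrix. -/
theorem IsWeakJacobiMatrix.exists_approximatesLinearOn {D : Set (EuclideanSpace ℝ (Fin n))}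
    {φ : EuclideanSpace ℝ (Fin n) → EuclideanSpace ℝ (Fin n)}
    {A : EuclideanSpace ℝ (Fin n) → Matrix (Fin n) (Fin n) ℝ}
    (h : IsWeakJacobiMatrix D φ A) (hD : IsOpen D) (hφ : ContinuousOn φ D) (hA : ∀ i j, Measurable fun x => A x i j)
    {δ : NNReal} (hδ : 0 < δ) :
    ∃ (t : (Fin n → ℕ × ℕ × ℕ) → Set (EuclideanSpace ℝ (Fin n)))
      (c : (Fin n → ℕ × ℕ × ℕ) → EuclideanSpace ℝ (Fin n) →L[ℝ] EuclideanSpace ℝ (Fin n)),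
      (∀ᵐ x ∂(volume.restrict D), ∃ l, x ∈ t l) ∧ ∀ l, t l ⊆ D ∧
        (∀ x ∈ t l, ‖Matrix.toEuclideanCLM (n := Fin n) (𝕜 := ℝ) (A x) - c l‖ ≤ δ) ∧
        ApproximatesLinearOn φ (c l) (t l) δ := by
  have hnorm : ∀ (v : EuclideanSpace ℝ (Fin n)) (b : ℝ), (∀ i, |v i| ≤ b) → ‖v‖ ≤ n * b := by
    intro v b hb
    conv_lhs => rw [← (EuclideanSpace.basisFun (Fin n) ℝ).sum_repr v]
    refine (norm_sum_le _ _).trans ?_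
    refine (Finset.sum_le_sum fun i _ => (?_ : _ ≤ b)).trans (by simp)
    simpa [norm_smul] using hb i
  -- Dividing `δ` by `K` leaves an error of at most `δ` after the `n` coordinate errors are added.
  set K : ℝ := n * (16 * 6 ^ n) + 1 with hK
  have hK0 : 0 < K := by positivity
  have hδK : 0 < (δ : ℝ) / K := div_pos hδ hK0
  have hrow : ∀ i, Measurable fun x => WithLp.toLp 2 (A x i) := fun i =>
    (PiLp.continuous_toLp 2 _).measurable.comp (measurable_pi_lambda _ (hA i))
  have hφi : ∀ i, ContinuousOn (fun x => φ x i) D := fun i =>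
    (EuclideanSpace.proj (𝕜 := ℝ) i).continuous.comp_continuousOn hφ
  choose t c ht hc using fun i => (h i).exists_linear_approx hD (hφi i) (hrow i) hδK
  let C : (Fin n → ℕ × ℕ × ℕ) → Matrix (Fin n) (Fin n) ℝ := fun l => Matrix.of fun i j =>
    c i (l i) j
  have hCapp : ∀ (B : Matrix (Fin n) (Fin n) ℝ) (v : EuclideanSpace ℝ (Fin n)) (i : Fin n),
      (Matrix.toEuclideanCLM (n := Fin n) (𝕜 := ℝ) B v) i =
        inner ℝ (WithLp.toLp 2 (B i)) v := by
    intro B v i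
    simp [PiLp.inner_apply, Matrix.mulVec, dotProduct, mul_comm]
  have hb1 : (n : ℝ) * (16 * 6 ^ n * (δ / K)) ≤ δ := by
    have : (n : ℝ) * (16 * 6 ^ n * (δ / K)) = (n * (16 * 6 ^ n) / K) * δ := by ring
    rw [this]
    exact mul_le_of_le_one_left δ.2 ((div_le_one hK0).2 (by linarith))
  have hb2 : (n : ℝ) * (δ / K) ≤ δ := by
    refine le_trans ?_ hb1
    gcongr
    have : (1 : ℝ) ≤ 6 ^ n := one_le_pow₀ (by norm_num)
    nlinarith
  -- For `n = 0` the intersection of the coordinate sets below is the whole space, which need not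
  -- lie in `D`.
  rcases isEmpty_or_nonempty (Fin n) with hn | hn
  · refine ⟨fun _ => D, fun _ => 0, ?_, fun l => ⟨subset_rfl, fun x _ => ?_, fun x _ y _ => ?_⟩⟩
    · filter_upwards [ae_restrict_mem hD.measurableSet] with x hx using ⟨fun _ => 0, hx⟩
    · rw [Subsingleton.elim (Matrix.toEuclideanCLM (n := Fin n) (𝕜 := ℝ) (A x) - 0) 0, norm_zero]
      exact δ.2
    · rw [Subsingleton.elim (φ x - φ y - _) 0, norm_zero]
      positivity
  refine ⟨fun l => ⋂ i, t i (l i), fun l => Matrix.toEuclideanCLM (n := Fin n) (𝕜 := ℝ) (C l),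
    ?_, fun l => ⟨?_, fun x hx => ?_, fun x hx y hy => ?_⟩⟩
  · filter_upwards [ae_all_iff.2 ht] with x hx
    choose l hl using hx
    exact ⟨l, mem_iInter.2 hl⟩
  · exact (iInter_subset _ hn.some).trans (hc _ _).1
  · rw [mem_iInter] at hx
    refine ContinuousLinearMap.opNorm_le_bound _ δ.2 fun v => ?_
    refine (hnorm _ (δ / K * ‖v‖) fun i => ?_).trans
      (le_of_eq_of_le (mul_assoc _ _ _).symm (by gcongr))
    rw [sub_apply, PiLp.sub_apply, hCapp, hCapp, ← inner_sub_left]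
    exact (abs_real_inner_le_norm _ _).trans (by gcongr; exact (hc i (l i)).2.1 x (hx i))
  · rw [mem_iInter] at hx hy
    refine (hnorm _ (16 * 6 ^ n * (δ / K) * ‖x - y‖) fun i => ?_).trans
      (le_of_eq_of_le (mul_assoc _ _ _).symm (by gcongr))
    rw [PiLp.sub_apply, hCapp]
    exact (hc i (l i)).2.2 x (hx i) y (hy i)

end LinearApproximation

/-! ### Differentiability on the pieces of a cover -/

section Differentiability

variable {E : Type*} [NormedAddCommGroup E] [NormedSpace ℝ E]

/-- The approximation sets are not known to be measurable; their relative closures in `D` are, and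
by continuity keep the same estimate. -/
theorem ApproximatesLinearOn.closure_inter {F : Type*} [NormedAddCommGroup F] [NormedSpace ℝ F]
    {f : E → F} {f' : E →L[ℝ] F} {s D : Set E} {δ : NNReal}
    (h : ApproximatesLinearOn f f' s δ) (hD : IsOpen D) (hf : ContinuousOn f D) :
    ApproximatesLinearOn f f' (closure s ∩ D) δ := by
  rintro x ⟨hxs, hxD⟩ y ⟨hys, hyD⟩
  have hmem : (x, y) ∈ closure (s ×ˢ s) := by
    rw [closure_prod_eq]; exact ⟨hxs, hys⟩
  obtain ⟨u, hu, hut⟩ := mem_closure_iff_seq_limit.1 hmem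
  have h1 := (continuous_fst.tendsto (x, y)).comp hut
  have h2 := (continuous_snd.tendsto (x, y)).comp hut
  have hfx := (hf.continuousAt (hD.mem_nhds hxD)).tendsto.comp h1
  have hfy := (hf.continuousAt (hD.mem_nhds hyD)).tendsto.comp h2
  have hlin := (f'.continuous.tendsto _).comp (h1.sub h2)
  exact le_of_tendsto_of_tendsto' ((hfx.sub hfy).sub hlin).norm ((h1.sub h2).norm.const_mul (δ : ℝ))
    fun k => h _ (hu k).1 _ (hu k).2

variable [FiniteDimensional ℝ E] [MeasurableSpace E] [BorelSpace E] (μ : Measure E)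
  [μ.IsAddHaarMeasure]

/-- If `f` is arbitrarily well approximated by linear maps close to `f'` on countable families of
sets that cover almost all of `D`, then almost all of `D` is covered by countably many measurable
sets on which `f` is differentiable with derivative `f'`. -/
theorem exists_cover_hasFDerivWithinAt {ι : Type*} [Countable ι] {D : Set E} (hD : IsOpen D)
    {f : E → E} (hf : ContinuousOn f D) {f' : E → E →L[ℝ] E}
    (H : ∀ δ : NNReal, 0 < δ → ∃ (t : ι → Set E) (c : ι → E →L[ℝ] E),
      (∀ᵐ x ∂(μ.restrict D), ∃ l, x ∈ t l) ∧ ∀ l, t l ⊆ D ∧ (∀ x ∈ t l, ‖f' x - c l‖ ≤ δ) ∧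
        ApproximatesLinearOn f (c l) (t l) δ) :
    ∃ T : ι → Set E, (∀ l, MeasurableSet (T l)) ∧ (∀ l, T l ⊆ D) ∧ μ (D \ ⋃ l, T l) = 0 ∧
      ∀ l, ∀ x ∈ T l, HasFDerivWithinAt f (f' x) (T l) x := by
  have hδ : ∀ k : ℕ, (0 : NNReal) < 1 / (k + 1) := fun k => by positivity
  choose t c ht hc using fun k : ℕ => H _ (hδ k)
  have hsm : ∀ k l, MeasurableSet (closure (t k l) ∩ D) := fun k l =>
    isClosed_closure.measurableSet.inter hD.measurableSet
  have hsa : ∀ k l, ApproximatesLinearOn f (c k l) (closure (t k l) ∩ D) (1 / (k + 1)) :=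
    fun k l => (hc k l).2.2.closure_inter hD hf
  have key : ∀ l, ∃ T, MeasurableSet T ∧ T ⊆ closure (t 0 l) ∩ D ∧
      μ ((closure (t 0 l) ∩ D) \ T) = 0 ∧ ∀ x ∈ T, HasFDerivWithinAt f (f' x) T x := by
    intro l
    set s := closure (t 0 l) ∩ D with hs
    have hsD : μ.restrict s ≤ μ.restrict D := Measure.restrict_mono_set μ inter_subset_right
    -- Being close to a linear map makes `f` Lipschitz on `s`, so this is Rademacher's theorem. Only
    -- the coarsest family forms the cover.
    have hd : ∀ᵐ x ∂(μ.restrict s), DifferentiableWithinAt ℝ f s x :=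
      (lipschitzOnWith_iff_restrict.2 (hsa 0 l).lipschitz).ae_differentiableWithinAt (hsm 0 l)
    obtain ⟨N, hN, hNm, hN0⟩ := exists_measurable_superset_of_null (ae_iff.1 hd)
    rw [Measure.restrict_apply hNm] at hN0
    have hdW : ∀ x ∈ s \ N, HasFDerivWithinAt f (fderivWithin ℝ f s x) (s \ N) x := by
      intro x hx
      have : DifferentiableWithinAt ℝ f s x := by
        by_contra hne
        exact hx.2 (hN hne)
      exact this.hasFDerivWithinAt.mono sdiff_subset
    have hclose : ∀ k j, ∀ᵐ x ∂μ, x ∈ (s \ N) ∩ (closure (t k j) ∩ D) →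
        ‖fderivWithin ℝ f s x - c k j‖ ≤ (1 / (k + 1) : NNReal) := by
      intro k j
      have hm := ((hsm 0 l).diff hNm).inter (hsm k j)
      rw [← ae_restrict_iff' hm]
      exact ((hsa k j).mono_set inter_subset_right).norm_fderiv_sub_le μ hm _
        fun x hx => (hdW x hx.1).mono inter_subset_left
    -- The finer families identify the derivative: at level `k` both it and `f' x` are within
    -- `1/(k+1)` of the same `c k j`.
    have heq : ∀ᵐ x ∂μ, x ∈ s \ N → fderivWithin ℝ f s x = f' x := by
      have hcov : ∀ᵐ x ∂μ, x ∈ D → ∀ k, ∃ j, x ∈ t k j :=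
        (ae_restrict_iff' hD.measurableSet).1 (ae_all_iff.2 ht)
      filter_upwards [hcov, ae_all_iff.2 fun k => ae_all_iff.2 (hclose k)] with x hx1 hx2 hxs
      rw [← sub_eq_zero, ← norm_le_zero_iff]
      have hlim : Filter.Tendsto (fun k : ℕ => 2 * (1 / ((k : ℝ) + 1))) Filter.atTop (𝓝 0) := by
        simpa using (tendsto_one_div_add_atTop_nhds_zero_nat (𝕜 := ℝ)).const_mul 2
      refine ge_of_tendsto' hlim fun k => ?_
      obtain ⟨j, hj⟩ := hx1 hxs.1.2 k
      have h1 := hx2 k j ⟨hxs, subset_closure hj, hxs.1.2⟩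
      have h2 := (hc k j).2.1 x hj
      have h3 := norm_sub_le_norm_sub_add_norm_sub (fderivWithin ℝ f s x) (c k j) (f' x)
      rw [norm_sub_rev (c k j)] at h3
      push_cast at h1 h2
      linarith
    obtain ⟨N', hN', hNm', hN0'⟩ := exists_measurable_superset_of_null (ae_iff.1 heq)
    refine ⟨(s \ N) \ N', ((hsm 0 l).diff hNm).diff hNm', fun x hx => hx.1.1, ?_, fun x hx => ?_⟩
    · refine measure_mono_null (t := (N ∩ s) ∪ N') (fun x hx => ?_)
        (measure_union_null hN0 hN0')
      by_cases h1 : x ∈ N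
      · exact Or.inl ⟨h1, hx.1⟩
      · exact Or.inr (by_contra fun h2 => hx.2 ⟨⟨hx.1, h1⟩, h2⟩)
    · have : fderivWithin ℝ f s x = f' x := by
        by_contra hne
        exact hx.2 (hN' fun h => hne (h hx.1))
      rw [← this]
      exact (hdW x hx.1).mono sdiff_subset
  choose T hTm hTs hT0 hTd using key
  refine ⟨T, hTm, fun l => (hTs l).trans inter_subset_right, ?_, hTd⟩
  have hcov : μ (D \ ⋃ l, t 0 l) = 0 := by
    have := ae_iff.1 ((ae_restrict_iff' hD.measurableSet).1 (ht 0))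
    refine measure_mono_null (fun x hx => ?_) this
    simp only [mem_ofPred_eq, Classical.not_imp]
    exact ⟨hx.1, fun ⟨l, hl⟩ => hx.2 (mem_iUnion.2 ⟨l, hl⟩)⟩
  refine measure_mono_null (fun x hx => ?_)
    (measure_union_null hcov (measure_iUnion_null hT0))
  by_cases h : ∃ l, x ∈ t 0 l
  · obtain ⟨l, hl⟩ := h
    exact Or.inr (mem_iUnion.2 ⟨l, ⟨subset_closure hl, hx.1⟩,
      fun hT => hx.2 (mem_iUnion.2 ⟨l, hT⟩)⟩)
  · exact Or.inl ⟨hx.1, fun hm => h (mem_iUnion.1 hm)⟩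

end Differentiability

/-! ### Norm and growth of the adjugate -/

section Matrices

variable {n : ℕ}

theorem matNorm_nonneg (M : Matrix (Fin n) (Fin n) ℝ) : 0 ≤ matNorm M := norm_nonneg _

theorem matNorm_zero : matNorm (0 : Matrix (Fin n) (Fin n) ℝ) = 0 := by simp [matNorm]

theorem matNorm_smul (c : ℝ) (M : Matrix (Fin n) (Fin n) ℝ) : matNorm (c • M) = |c| * matNorm M := by
  simp only [matNorm, map_smul, norm_smul, Real.norm_eq_abs]

theorem continuous_matNorm : Continuous (matNorm (n := n)) := by
  let L : Matrix (Fin n) (Fin n) ℝ →ₗ[ℝ] EuclideanSpace ℝ (Fin n) →L[ℝ] EuclideanSpace ℝ (Fin n) :=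
    { toFun := Matrix.toEuclideanCLM (n := Fin n) (𝕜 := ℝ)
      map_add' := map_add _
      map_smul' := map_smul _ }
  exact continuous_norm.comp L.continuous_of_finiteDimensional

theorem continuous_matNorm_adjugate :
    Continuous fun B : Fin n → Fin n → ℝ => matNorm (Matrix.of B).adjugate :=
  continuous_matNorm.comp (Continuous.matrix_adjugate continuous_id)

/-- The adjugate is homogeneous of degree `n - 1` and bounded on the compact unit ball. -/
theorem exists_matNorm_adjugate_le (hn : 2 ≤ n) : ∃ C : ℝ, 0 ≤ C ∧ ∀ B : Fin n → Fin n → ℝ,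
    matNorm (Matrix.of B).adjugate ≤ C * ‖B‖ ^ (n - 1) := by
  obtain ⟨C, hC⟩ := (isCompact_closedBall (0 : Fin n → Fin n → ℝ) 1).exists_bound_of_continuousOn
    continuous_matNorm_adjugate.continuousOn
  have hC0 : 0 ≤ C := (norm_nonneg _).trans (hC 0 (by simp))
  refine ⟨C, hC0, fun B => ?_⟩
  have : Nontrivial (Fin n) := Fin.nontrivial_iff_two_le.2 hn
  rcases eq_or_ne B 0 with rfl | hB
  · have : Matrix.of (0 : Fin n → Fin n → ℝ) = 0 := rfl
    rw [this, Matrix.adjugate_zero, matNorm_zero]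
    positivity
  · have hr : 0 < ‖B‖ := norm_pos_iff.2 hB
    have e : Matrix.of B = ‖B‖ • Matrix.of (‖B‖⁻¹ • B) := by
      ext i j
      simp [hr.ne']
    rw [e, Matrix.adjugate_smul, matNorm_smul, Fintype.card_fin, abs_of_pos (by positivity),
      mul_comm]
    gcongr
    refine (le_abs_self _).trans (hC _ ?_)
    rw [mem_closedBall_zero_iff, norm_smul, norm_inv, norm_norm, inv_mul_cancel₀ hr.ne']

theorem det_toEuclideanCLM (M : Matrix (Fin n) (Fin n) ℝ) :
    (Matrix.toEuclideanCLM (n := Fin n) (𝕜 := ℝ) M).det = M.det := by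
  rw [ContinuousLinearMap.det, Matrix.toEuclideanCLM]
  exact LinearMap.det_toLin (PiLp.basisFun 2 ℝ (Fin n)) M

end Matrices

/-! ### Uniqueness of weak gradients and integrability of the adjugate -/

section Uniqueness

variable {n : ℕ}

/-- By the fundamental lemma of the calculus of variations. It lets an arbitrary representative of
`Dφ` inherit the `L_q` bound of the gradients in `MapMemSobolevL1`. -/
theorem HasWeakGradientOn.ae_eq {D : Set (EuclideanSpace ℝ (Fin n))}
    {f : EuclideanSpace ℝ (Fin n) → ℝ} {g g' : EuclideanSpace ℝ (Fin n) → EuclideanSpace ℝ (Fin n)}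
    (h : HasWeakGradientOn D f g) (h' : HasWeakGradientOn D f g') (hD : IsOpen D) :
    g =ᵐ[volume.restrict D] g' := by
  have key : ∀ i, ∀ᵐ x ∂(volume : Measure (EuclideanSpace ℝ (Fin n))),
      x ∈ D → g x i - g' x i = 0 := by
    intro i
    have hloc : ∀ u : EuclideanSpace ℝ (Fin n) → EuclideanSpace ℝ (Fin n),
        LocallyIntegrableOn u D volume → LocallyIntegrableOn (fun x => u x i) D volume := by
      intro u hu
      rw [locallyIntegrableOn_iff hD.isLocallyClosed] at hu ⊢
      exact fun K hK hKc => (EuclideanSpace.proj (𝕜 := ℝ) i).integrable_comp (hu K hK hKc)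
    have hint : ∀ (u : EuclideanSpace ℝ (Fin n) → EuclideanSpace ℝ (Fin n)),
        LocallyIntegrableOn u D volume → ∀ η : EuclideanSpace ℝ (Fin n) → ℝ, Continuous η →
        HasCompactSupport η → tsupport η ⊆ D →
        Integrable (fun x => u x i * η x) (volume.restrict D) := by
      intro u hu η h1 h2 h3
      refine IntegrableOn.of_forall_sdiff_eq_zero (IntegrableOn.mul_continuousOn (K := tsupport η)
        ((hloc u hu).integrableOn_compact_subset h3 h2)
        h1.continuousOn h2) hD.measurableSet fun x hx => ?_
      simp [image_eq_zero_of_notMem_tsupport hx.2]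
    refine hD.ae_eq_zero_of_integral_contDiff_smul_eq_zero
      ((hloc g h.2.1).sub (hloc g' h'.2.1)) fun η h1 h2 h3 => ?_
    have e1 := h.2.2 η h1 h2 h3 i
    rw [h'.2.2 η h1 h2 h3 i, neg_inj] at e1
    rw [← setIntegral_eq_integral_of_forall_compl_eq_zero (s := D) fun x hx => by
      simp [image_eq_zero_of_notMem_tsupport fun h => hx (h3 h)]]
    have e2 : ∀ x, η x • (g x i - g' x i) = g x i * η x - g' x i * η x := fun x => by
      rw [smul_eq_mul]; ring
    simp_rw [e2]
    rw [integral_sub (hint g h.2.1 η h1.continuous h2 h3)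
      (hint g' h'.2.1 η h1.continuous h2 h3), e1, sub_self]
  rw [Filter.EventuallyEq, ae_restrict_iff' hD.measurableSet]
  filter_upwards [ae_all_iff.2 key] with x hx hxD
  ext i
  exact sub_eq_zero.1 (hx i hxD)

theorem IsWeakJacobiMatrix.memLp_row {D : Set (EuclideanSpace ℝ (Fin n))} {q : ℝ≥0∞}
    {φ : EuclideanSpace ℝ (Fin n) → EuclideanSpace ℝ (Fin n)}
    {A : EuclideanSpace ℝ (Fin n) → Matrix (Fin n) (Fin n) ℝ}
    (h : IsWeakJacobiMatrix D φ A) (hD : IsOpen D) (hφ : MapMemSobolevL1 q D φ) (i : Fin n) :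
    MemLp (fun x => WithLp.toLp 2 (A x i)) q (volume.restrict D) := by
  obtain ⟨g, hg, hgq⟩ := hφ i
  exact hgq.ae_eq (hg.ae_eq (h i) hD)

/-- On a compact set, which has finite measure, `L_q` embeds in `L_{n-1}`, and this matches the
growth of the adjugate. -/
theorem IsWeakJacobiMatrix.lintegral_adjugate_lt_top (hn : 2 ≤ n)
    {D : Set (EuclideanSpace ℝ (Fin n))} {q : ℝ≥0∞} (hq : (n : ℝ≥0∞) - 1 < q)
    {φ : EuclideanSpace ℝ (Fin n) → EuclideanSpace ℝ (Fin n)}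
    {A : EuclideanSpace ℝ (Fin n) → Matrix (Fin n) (Fin n) ℝ}
    (h : IsWeakJacobiMatrix D φ A) (hD : IsOpen D) (hφ : MapMemSobolevL1 q D φ)
    {K : Set (EuclideanSpace ℝ (Fin n))} (hK : IsCompact K) (hKD : K ⊆ D) :
    ∫⁻ x in K, ENNReal.ofReal (matNorm (A x).adjugate) < ∞ := by
  obtain ⟨C, hC0, hC⟩ := exists_matNorm_adjugate_le hn
  set u : EuclideanSpace ℝ (Fin n) → ℝ := fun x => ∑ i, ‖WithLp.toLp 2 (A x i)‖ with hu
  have hu0 : ∀ x, 0 ≤ u x := fun x => Finset.sum_nonneg fun i _ => norm_nonneg _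
  have hAu : ∀ x, ‖(fun i j => A x i j : Fin n → Fin n → ℝ)‖ ≤ u x := by
    intro x
    rw [pi_norm_le_iff_of_nonneg (hu0 x)]
    intro i
    rw [pi_norm_le_iff_of_nonneg (hu0 x)]
    intro j
    exact (PiLp.norm_apply_le (WithLp.toLp 2 (A x i)) j).trans
      (Finset.single_le_sum (f := fun i => ‖WithLp.toLp 2 (A x i)‖)
        (fun i _ => norm_nonneg _) (Finset.mem_univ i))
  have hup : MemLp u ((n - 1 : ℕ) : ℝ≥0∞) (volume.restrict K) := by
    have : IsFiniteMeasure (volume.restrict K) := ⟨by simpa using hK.measure_lt_top⟩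
    have h1 : MemLp u q (volume.restrict K) :=
      (memLp_finsetSum _ fun i _ => (h.memLp_row hD hφ i).norm).mono_measure
        (Measure.restrict_mono_set _ hKD)
    refine h1.mono_exponent (le_trans ?_ hq.le)
    simp
  have hfin : ∫⁻ x in K, ‖u x‖ₑ ^ ((n - 1 : ℕ) : ℝ) < ∞ := by
    have := lintegral_rpow_enorm_lt_top_of_eLpNorm_lt_top
      (Nat.cast_ne_zero.2 (by omega : n - 1 ≠ 0)) (ENNReal.natCast_ne_top _) hup.2
    rwa [ENNReal.toReal_natCast] at this
  have hle : ∀ x, ENNReal.ofReal (matNorm (A x).adjugate) ≤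
      ENNReal.ofReal C * ‖u x‖ₑ ^ ((n - 1 : ℕ) : ℝ) := by
    intro x
    rw [← ofReal_norm, Real.norm_of_nonneg (hu0 x), ENNReal.rpow_natCast, ← ENNReal.ofReal_pow
      (hu0 x), ← ENNReal.ofReal_mul hC0]
    refine ENNReal.ofReal_le_ofReal ((hC (fun i j => A x i j)).trans ?_)
    gcongr
    exact hAu x
  refine (lintegral_mono hle).trans_lt ?_
  rw [lintegral_const_mul' _ _ ENNReal.ofReal_ne_top]
  exact ENNReal.mul_lt_top ENNReal.ofReal_lt_top hfin

end Uniqueness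

/-! ### Decomposition of the domain and area formula -/

section ChangeOfVariables

variable {n : ℕ}

/-- Almost all of the domain of a continuous mapping with weak Jacobi matrix `A` is covered by
disjoint measurable sets on which the mapping is differentiable with derivative `A`. -/
theorem IsWeakJacobiMatrix.exists_cover {D : Set (EuclideanSpace ℝ (Fin n))}
    {φ : EuclideanSpace ℝ (Fin n) → EuclideanSpace ℝ (Fin n)}
    {A : EuclideanSpace ℝ (Fin n) → Matrix (Fin n) (Fin n) ℝ}
    (h : IsWeakJacobiMatrix D φ A) (hD : IsOpen D) (hφ : ContinuousOn φ D) :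
    ∃ (A' : EuclideanSpace ℝ (Fin n) → Matrix (Fin n) (Fin n) ℝ)
      (T : ℕ → Set (EuclideanSpace ℝ (Fin n))),
      (∀ i j, Measurable fun x => A' x i j) ∧ (∀ l, MeasurableSet (T l)) ∧
      Pairwise (Function.onFun Disjoint T) ∧ (∀ l, T l ⊆ D) ∧ volume (D \ ⋃ l, T l) = 0 ∧
      (∀ l, ∀ x ∈ T l, A x = A' x) ∧
      ∀ l, ∀ x ∈ T l, HasFDerivWithinAt φ (Matrix.toEuclideanCLM (n := Fin n) (𝕜 := ℝ) (A x))
        (T l) x := by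
  have hAm : ∀ i j, AEMeasurable (fun x => A x i j) (volume.restrict D) := by
    intro i j
    have h1 := ((h i).2.1.aestronglyMeasurable).aemeasurable
    exact (EuclideanSpace.proj (𝕜 := ℝ) j).continuous.measurable.comp_aemeasurable h1
  let A' : EuclideanSpace ℝ (Fin n) → Matrix (Fin n) (Fin n) ℝ := fun x => Matrix.of fun i j =>
    (hAm i j).mk _ x
  have hA'm : ∀ i j, Measurable fun x => A' x i j := fun i j => (hAm i j).measurable_mk
  have hAA' : ∀ᵐ x ∂(volume.restrict D), A x = A' x := by
    filter_upwards [ae_all_iff.2 fun i => ae_all_iff.2 fun j => (hAm i j).ae_eq_mk] with x hx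
    ext i j
    exact hx i j
  have h' : IsWeakJacobiMatrix D φ A' := fun i => (h i).congr hD (hAA'.mono fun x hx => by
    simp only [hx])
  obtain ⟨T, hTm, hTD, hT0, hTd⟩ := exists_cover_hasFDerivWithinAt volume hD hφ
    (f' := fun x => Matrix.toEuclideanCLM (n := Fin n) (𝕜 := ℝ) (A' x))
    fun δ hδ => h'.exists_approximatesLinearOn hD hφ hA'm hδ
  obtain ⟨N, hN, hNm, hN0⟩ := exists_measurable_superset_of_null
    (ae_iff.1 ((ae_restrict_iff' hD.measurableSet).1 hAA'))
  obtain ⟨e, he⟩ := exists_surjective_nat (Fin n → ℕ × ℕ × ℕ)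
  -- Removing `N` makes `A` agree with its measurable version everywhere on the pieces, so the
  -- derivative is the given representative.
  set U : ℕ → Set (EuclideanSpace ℝ (Fin n)) := fun k => T (e k) \ N with hU
  have hUm : ∀ k, MeasurableSet (U k) := fun k => (hTm _).diff hNm
  have hsub : ∀ k, disjointed U k ⊆ T (e k) := fun k => (disjointed_subset U k).trans sdiff_subset
  have heq : ∀ k, ∀ x ∈ disjointed U k, A x = A' x := by
    intro k x hx
    have hxU := disjointed_subset U k hx
    by_contra hne
    exact hxU.2 (hN fun hh => hne (hh (hTD _ hxU.1)))
  refine ⟨A', disjointed U, hA'm, fun k => MeasurableSet.disjointed hUm k, disjoint_disjointed U,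
    fun k => (hsub k).trans (hTD _), ?_, heq, fun k x hx => ?_⟩
  · rw [iUnion_disjointed]
    refine measure_mono_null (fun x hx => ?_) (measure_union_null hT0 hN0)
    by_cases hxN : x ∈ N
    · exact Or.inr hxN
    · refine Or.inl ⟨hx.1, fun hm => hx.2 ?_⟩
      obtain ⟨l, hl⟩ := mem_iUnion.1 hm
      obtain ⟨k, rfl⟩ := he l
      exact mem_iUnion.2 ⟨k, hl, hxN⟩
  · rw [heq k x hx]
    exact (hTd _ x (hsub k hx)).mono (hsub k)

theorem volume_image_eq_zero_of_subset_iUnion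
    {φ : EuclideanSpace ℝ (Fin n) → EuclideanSpace ℝ (Fin n)}
    {φ' : EuclideanSpace ℝ (Fin n) → EuclideanSpace ℝ (Fin n) →L[ℝ] EuclideanSpace ℝ (Fin n)}
    {T : ℕ → Set (EuclideanSpace ℝ (Fin n))}
    (hT : ∀ l, ∀ x ∈ T l, HasFDerivWithinAt φ (φ' x) (T l) x)
    {N : Set (EuclideanSpace ℝ (Fin n))} (hN : N ⊆ ⋃ l, T l) (hN0 : volume N = 0) :
    volume (φ '' N) = 0 := by
  have : N = ⋃ l, N ∩ T l := by rw [← inter_iUnion, inter_eq_left.2 hN]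
  rw [this, image_iUnion]
  refine measure_iUnion_null fun l => ?_
  refine addHaar_image_eq_zero_of_differentiableOn_of_addHaar_eq_zero volume (fun x hx => ?_)
    (measure_mono_null inter_subset_left hN0)
  exact ((hT l x hx.2).mono inter_subset_right).differentiableWithinAt

theorem lintegral_image_iUnion_eq {D : Set (EuclideanSpace ℝ (Fin n))}
    {φ : EuclideanSpace ℝ (Fin n) → EuclideanSpace ℝ (Fin n)}
    {φ' : EuclideanSpace ℝ (Fin n) → EuclideanSpace ℝ (Fin n) →L[ℝ] EuclideanSpace ℝ (Fin n)}
    (hφ : ContinuousOn φ D) (hinj : InjOn φ D)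
    {T : ℕ → Set (EuclideanSpace ℝ (Fin n))} (hTm : ∀ l, MeasurableSet (T l))
    (hTdisj : Pairwise (Function.onFun Disjoint T)) (hTD : ∀ l, T l ⊆ D)
    (hT : ∀ l, ∀ x ∈ T l, HasFDerivWithinAt φ (φ' x) (T l) x)
    {B : Set (EuclideanSpace ℝ (Fin n))} (hB : MeasurableSet B)
    (w : EuclideanSpace ℝ (Fin n) → ℝ≥0∞) :
    ∫⁻ y in φ '' (B ∩ ⋃ l, T l), w y =
      ∫⁻ x in B ∩ ⋃ l, T l, ENNReal.ofReal |(φ' x).det| * w (φ x) := by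
  have hm : ∀ l, MeasurableSet (B ∩ T l) := fun l => hB.inter (hTm l)
  have hsub : ∀ l, B ∩ T l ⊆ D := fun l => inter_subset_right.trans (hTD l)
  have hdisj : Pairwise (Function.onFun Disjoint fun l => B ∩ T l) := fun i j hij =>
    (hTdisj hij).mono inter_subset_right inter_subset_right
  rw [inter_iUnion, image_iUnion, lintegral_iUnion, lintegral_iUnion hm hdisj]
  · refine tsum_congr fun l => ?_
    exact lintegral_image_eq_lintegral_abs_det_fderiv_mul volume (hm l)
      (fun x hx => (hT l x hx.2).mono inter_subset_right) (hinj.mono (hsub l)) w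
  · exact fun l => (hm l).image_of_continuousOn_injOn (hφ.mono (hsub l)) (hinj.mono (hsub l))
  · intro i j hij
    exact (hdisj hij).image hinj (hsub i) (hsub j)

end ChangeOfVariables

/-! ### Integration of the function `μ` -/

section DistortionFunction

variable {n : ℕ}

theorem muFun_of_mem {φ : OpenPartialHomeomorph (EuclideanSpace ℝ (Fin n))
      (EuclideanSpace ℝ (Fin n))}
    {A : EuclideanSpace ℝ (Fin n) → Matrix (Fin n) (Fin n) ℝ} {S : Set (EuclideanSpace ℝ (Fin n))}
    {x : EuclideanSpace ℝ (Fin n)} (hx : x ∈ φ.source) (hxS : x ∉ S) :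
    muFun φ A S (φ x) = matNorm (A x).adjugate / |(A x).det| := by
  by_cases hdet : (A x).det = 0 <;> simp [muFun, φ.left_inv hx, hx, hxS, hdet]

theorem muFun_of_mem_exceptional {φ : OpenPartialHomeomorph (EuclideanSpace ℝ (Fin n))
      (EuclideanSpace ℝ (Fin n))}
    {A : EuclideanSpace ℝ (Fin n) → Matrix (Fin n) (Fin n) ℝ} {S : Set (EuclideanSpace ℝ (Fin n))}
    {x : EuclideanSpace ℝ (Fin n)} (hx : x ∈ φ.source) (hxS : x ∈ S) :
    muFun φ A S (φ x) = 0 := by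
  simp [muFun, φ.left_inv hx, hxS]

theorem muFun_nonneg (φ : OpenPartialHomeomorph (EuclideanSpace ℝ (Fin n))
      (EuclideanSpace ℝ (Fin n)))
    (A : EuclideanSpace ℝ (Fin n) → Matrix (Fin n) (Fin n) ℝ) (S : Set (EuclideanSpace ℝ (Fin n)))
    (y : EuclideanSpace ℝ (Fin n)) : 0 ≤ muFun φ A S y := by
  unfold muFun
  split_ifs
  · exact div_nonneg (matNorm_nonneg _) (abs_nonneg _)
  · exact le_rfl

/-- Outside the image of a set of full measure, `muFun` vanishes almost everywhere. -/
theorem IsExceptionalSet.ae_muFun_eq_zero {φ : OpenPartialHomeomorph (EuclideanSpace ℝ (Fin n))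
      (EuclideanSpace ℝ (Fin n))}
    {A : EuclideanSpace ℝ (Fin n) → Matrix (Fin n) (Fin n) ℝ} {S G : Set (EuclideanSpace ℝ (Fin n))}
    (hS : IsExceptionalSet φ.source φ S) (hG : volume (φ.source \ G) = 0) :
    ∀ᵐ y, y ∈ φ.target → y ∉ φ '' (φ.source ∩ G) → muFun φ A S y = 0 := by
  -- The image of `S` may have positive measure, but `μ` is zero there by definition; the Luzin
  -- property disposes of the rest.
  have h0 : volume (φ '' ((φ.source \ G) \ S)) = 0 :=
    hS.2.2 _ (sdiff_subset_sdiff_left sdiff_subset) (measure_mono_null sdiff_subset hG)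
  filter_upwards [measure_eq_zero_iff_ae_notMem.1 h0] with y hy hyt hyG
  obtain ⟨x, hx, rfl⟩ : ∃ x ∈ φ.source, φ x = y := ⟨φ.symm y, φ.map_target hyt, φ.right_inv hyt⟩
  by_cases hxS : x ∈ S
  · exact muFun_of_mem_exceptional hx hxS
  · exact absurd ⟨x, ⟨⟨hx, fun h => hyG ⟨x, ⟨hx, h⟩, rfl⟩⟩, hxS⟩, rfl⟩ hy

variable {φ : OpenPartialHomeomorph (EuclideanSpace ℝ (Fin n)) (EuclideanSpace ℝ (Fin n))}
  {A : EuclideanSpace ℝ (Fin n) → Matrix (Fin n) (Fin n) ℝ}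

theorem IsWeakJacobiMatrix.exists_isExceptionalSet (h : IsWeakJacobiMatrix φ.source φ A) :
    ∃ S, IsExceptionalSet φ.source φ S := by
  obtain ⟨A', T, -, -, -, -, hT0, -, hTd⟩ := h.exists_cover φ.open_source φ.continuousOn
  refine ⟨φ.source \ ⋃ l, T l, sdiff_subset, hT0, fun N hN hN0 => ?_⟩
  refine volume_image_eq_zero_of_subset_iUnion hTd (fun x hx => ?_) hN0
  by_contra hne
  exact (hN hx).2 ⟨(hN hx).1, hne⟩

theorem IsWeakJacobiMatrix.aemeasurable_muFun (h : IsWeakJacobiMatrix φ.source φ A)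
    {S : Set (EuclideanSpace ℝ (Fin n))} (hS : IsExceptionalSet φ.source φ S) :
    AEMeasurable (muFun φ A S) (volume.restrict φ.target) := by
  obtain ⟨A', T, hA'm, hTm, hTdisj, hTD, hT0, hAA', hTd⟩ :=
    h.exists_cover φ.open_source φ.continuousOn
  set G := ⋃ l, T l with hG
  have hGD : G ⊆ φ.source := iUnion_subset hTD
  have hGm : MeasurableSet G := MeasurableSet.iUnion hTm
  have hm : Measurable fun x => matNorm (A' x).adjugate / |(A' x).det| := by
    have hA' : Measurable fun x => (fun i j => A' x i j : Fin n → Fin n → ℝ) :=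
      measurable_pi_lambda _ fun i => measurable_pi_lambda _ fun j => hA'm i j
    have hdet : Continuous fun B : Fin n → Fin n → ℝ => |(Matrix.of B).det| :=
      (Continuous.matrix_det continuous_id).abs
    exact (continuous_matNorm_adjugate.measurable.comp hA').div (hdet.measurable.comp hA')
  have hsymm : AEMeasurable φ.symm (volume.restrict φ.target) :=
    φ.continuousOn_symm.aemeasurable φ.open_target.measurableSet
  have himg : MeasurableSet (φ '' G) :=
    hGm.image_of_continuousOn_injOn (φ.continuousOn.mono hGD) (φ.injOn.mono hGD)
  refine ((hm.comp_aemeasurable hsymm).indicator himg).congr ?_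
  -- On `φ(G ∩ S)` the quotient formula may differ from `μ = 0`, but `φ` has the Luzin property on
  -- `G`, so this set is negligible.
  have h0 : volume (φ '' (G ∩ S)) = 0 := volume_image_eq_zero_of_subset_iUnion hTd
    inter_subset_left (measure_mono_null inter_subset_right hS.2.1)
  rw [Filter.EventuallyEq, ae_restrict_iff' φ.open_target.measurableSet]
  filter_upwards [measure_eq_zero_iff_ae_notMem.1 h0, hS.ae_muFun_eq_zero (A := A) hT0]
    with y hy1 hy2 hyt
  by_cases hyG : y ∈ φ '' G
  · obtain ⟨x, hx, rfl⟩ := hyG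
    have hxS : x ∉ S := fun hxS => hy1 ⟨x, ⟨hx, hxS⟩, rfl⟩
    rw [indicator_of_mem (mem_image_of_mem φ hx), muFun_of_mem (hGD hx) hxS]
    obtain ⟨l, hl⟩ := mem_iUnion.1 hx
    simp only [Function.comp_apply, φ.left_inv (hGD hx), hAA' l x hl]
  · rw [indicator_of_notMem hyG, hy2 hyt]
    rwa [inter_eq_right.2 hGD]

open Classical in
/-- The change of variables formula for `muFun`. -/
theorem IsWeakJacobiMatrix.lintegral_muFun (h : IsWeakJacobiMatrix φ.source φ A)
    {S : Set (EuclideanSpace ℝ (Fin n))} (hS : IsExceptionalSet φ.source φ S)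
    {B : Set (EuclideanSpace ℝ (Fin n))} (hB : MeasurableSet B) (hBD : B ⊆ φ.source) :
    ∫⁻ y in φ '' B, ENNReal.ofReal (muFun φ A S y) =
      ∫⁻ x in B, if (A x).det = 0 then 0 else ENNReal.ofReal (matNorm (A x).adjugate) := by
  obtain ⟨A', T, -, hTm, hTdisj, hTD, hT0, -, hTd⟩ :=
    h.exists_cover φ.open_source φ.continuousOn
  set G := ⋃ l, T l with hG
  have hGD : G ⊆ φ.source := iUnion_subset hTD
  have hGm : MeasurableSet G := MeasurableSet.iUnion hTm
  have hmB : MeasurableSet (φ '' (B \ G)) := (hB.diff hGm).image_of_continuousOn_injOn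
    (φ.continuousOn.mono (sdiff_subset.trans hBD)) (φ.injOn.mono (sdiff_subset.trans hBD))
  have hdisj : Disjoint (φ '' (B ∩ G)) (φ '' (B \ G)) :=
    disjoint_sdiff_inter.symm.image φ.injOn (inter_subset_left.trans hBD) (sdiff_subset.trans hBD)
  have hzero : ∫⁻ y in φ '' (B \ G), ENNReal.ofReal (muFun φ A S y) = 0 := by
    rw [lintegral_eq_zero_of_ae_eq_zero]
    rw [Filter.EventuallyEq, ae_restrict_iff' hmB]
    filter_upwards [hS.ae_muFun_eq_zero (A := A) hT0] with y hy hyB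
    obtain ⟨x, hx, rfl⟩ := hyB
    rw [hy (φ.map_source (hBD hx.1)), ENNReal.ofReal_zero, Pi.zero_apply]
    rintro ⟨x', hx', hxx'⟩
    exact hx.2 (φ.injOn hx'.1 (hBD hx.1) hxx' ▸ hx'.2)
  have himg : φ '' B = φ '' (B ∩ G) ∪ φ '' (B \ G) := by
    rw [← image_union, inter_union_sdiff]
  rw [himg, lintegral_union hmB hdisj, hzero, add_zero,
    lintegral_image_iUnion_eq φ.continuousOn φ.injOn hTm hTdisj hTD hTd hB]
  have hBG : (B ∩ G : Set _) =ᵐ[volume] B := by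
    rw [Filter.eventuallyEq_set]
    filter_upwards [measure_eq_zero_iff_ae_notMem.1 hT0] with x hx
    exact ⟨fun h => h.1, fun h => ⟨h, by_contra fun hne => hx ⟨hBD h, hne⟩⟩⟩
  rw [← setLIntegral_congr hBG]
  refine setLIntegral_congr_fun_ae (hB.inter hGm) ?_
  filter_upwards [measure_eq_zero_iff_ae_notMem.1 hS.2.1] with x hxS hx
  -- The Jacobian of the area formula cancels the denominator of `μ`, and annihilates the integrand
  -- where `J = 0`.
  rw [det_toEuclideanCLM, muFun_of_mem (hBD hx.1) hxS, ← ENNReal.ofReal_mul (abs_nonneg _)]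
  split_ifs with hdet
  · simp [hdet]
  · rw [mul_div_cancel₀ _ (abs_ne_zero.2 hdet)]

end DistortionFunction

/-! ### The theorem -/

theorem lemma2 {n : ℕ} (hn : 2 ≤ n) (D D' : Set (EuclideanSpace ℝ (Fin n)))
    (hD : IsOpen D) (hDc : IsConnected D) (hD' : IsOpen D') (hDc' : IsConnected D')
    (φ : OpenPartialHomeomorph (EuclideanSpace ℝ (Fin n)) (EuclideanSpace ℝ (Fin n)))
    (hsource : φ.source = D) (htarget : φ.target = D')
    (q : ℝ≥0∞) (hq : (n : ℝ≥0∞) - 1 < q) (hφ : MapMemSobolevL1 q D φ)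
    (A : EuclideanSpace ℝ (Fin n) → Matrix (Fin n) (Fin n) ℝ)
    (hA : IsWeakJacobiMatrix D φ A) :
    (∃ S : Set (EuclideanSpace ℝ (Fin n)), IsExceptionalSet D φ S) ∧
      ∀ S : Set (EuclideanSpace ℝ (Fin n)), IsExceptionalSet D φ S →
        LocallyIntegrableOn (muFun φ A S) D' volume ∧
          (FiniteDistortion D A →
            ∫⁻ y in D', ENNReal.ofReal (muFun φ A S y) =
              ∫⁻ x in D, ENNReal.ofReal (matNorm (A x).adjugate)) := by
  classical
  subst hsource htarget
  refine ⟨hA.exists_isExceptionalSet, fun S hS => ⟨?_, fun hfd => ?_⟩⟩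
  · rw [locallyIntegrableOn_iff hD'.isLocallyClosed]
    intro K hK hKc
    have hKc' : IsCompact (φ.symm '' K) := hKc.image_of_continuousOn (φ.continuousOn_symm.mono hK)
    have hKs : φ.symm '' K ⊆ φ.source := by
      rintro _ ⟨y, hy, rfl⟩
      exact φ.map_target (hK hy)
    have himg : φ '' (φ.symm '' K) = K := by
      rw [image_image]
      exact (image_congr fun y hy => φ.right_inv (hK hy)).trans (image_id' K)
    refine ⟨(hA.aemeasurable_muFun hS).aestronglyMeasurable.mono_measure
      (Measure.restrict_mono_set _ hK), ?_⟩
    rw [hasFiniteIntegral_iff_ofReal (Filter.Eventually.of_forall (muFun_nonneg φ A S)), ← himg,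
      hA.lintegral_muFun hS hKc'.measurableSet hKs]
    refine (lintegral_mono fun x => ?_).trans_lt
      (hA.lintegral_adjugate_lt_top hn hq hD hφ hKc' hKs)
    dsimp only
    split_ifs
    · exact zero_le
    · exact le_rfl
  -- The adjugate of the zero matrix is zero only for `n ≠ 1`; for `n = 1` it is the identity.
  · have : Nontrivial (Fin n) := Fin.nontrivial_iff_two_le.2 hn
    rw [← φ.image_source_eq_target, hA.lintegral_muFun hS hD.measurableSet subset_rfl]
    refine lintegral_congr_ae (hfd.mono fun x hx => ?_)
    dsimp only
    split_ifs with hdet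
    · rw [hx hdet, Matrix.adjugate_zero, matNorm_zero, ENNReal.ofReal_zero]
    · rfl
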